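/- Let $\mathbb H$ be the quaternions, $\mathbb S=\{x\in\mathbb H:\operatorname{Re}x=0,\ |x|=1\}$, and let $V$ be a quaternionic right Banach space with algebra $\mathcal B(V)$ of bounded right linear operators. For $T\in\mathcal B(V)$ let $\sigma_S(T)$ be the set of all $s\in\mathbb H$ for which $T^2-2\operatorname{Re}(s)T+|s|^2\mathcal I$ has no inverse in $\mathcal B(V)$. Let $\mathsf B_S$ be the $\sigma$-algebra of axially symmetric Borel sets of $\mathbb H$, i.e. of those Borel sets that contain with $x$ the whole sphere $\{\operatorname{Re}x+\mathsf i|\operatorname{Im}x|:\mathsf i\in\mathbb S\}$. A spectral measure is a map $E:\mathsf B_S\to\mathcal B(V)$ whose values are uniformly bounded projections, with $E(\emptyset)=0$, $E(\mathbb H)=\mathcal I$, $E(\Delta_1\cap\Delta_2)=E(\Delta_1)E(\Delta_2)$, and $E(\bigcup_n\Delta_n)v=\sum_nE(\Delta_n)v$ for all $v\in V$ and all sequences of pairwise disjoint $\Delta_n\in\mathsf B_S$. It is a spectral resolution of $T$ if for all $\Delta\in\mathsf B_S$ it satisfies $E(\Delta)T=TE(\Delta)$ and $\sigma_S(T|_{\operatorname{ran}E(\Delta)})\subset\overline\Delta$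 (the closure of $\Delta$). An operator $J\in\mathcal B(V)$ is imaginary if $-J^2$ is the projection onto $\operatorname{ran}J$ along $\ker J$. A pair $(E,J)$ is a spectral decomposition of $T$ (and $J$ is a spectral orientation of $T$) if $E$ is a spectral resolution of $T$, $J$ is an imaginary operator that commutes with $T$ and with all $E(\Delta)$, $E(\mathbb H\setminus\mathbb R)=-J^2$, and for all $s_0\in\mathbb R$, $s_1>0$ the restriction of $s_0\mathcal I-s_1J-T$ to $\operatorname{ran}E(\mathbb H\setminus\mathbb R)=\operatorname{ran}J$ has a bounded inverse on this space. **Proposition.** Let $T\in\mathcal B(V)$ have a spectral resolution $E$ and suppose $\sigma_S(T)\cap\mathbb R=\emptyset$. Then there is an imaginary operator $J\in\mathcal B(V)$ such that $(E,J)$ is a spectral decomposition of $T$. This $J$ is the unique spectral orientation of $T$: if $(E',J')$ is any spectral decomposition of $T$, then $J'=J$. Moreover, let $\mathsf i\in\mathbb S$, let $V_{\mathsf i}$ be $V$ regarded as a complex Banach space by restricting the right scalar multiplication to $\mathbb C_{\mathsf i}=\mathbb R+\mathsf i\mathbb R$ (identified with $\mathbb C$), and let $\sigma_\pm$ be the parts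 of the spectrum of $T$ on $V_{\mathsf i}$ in the open upper and lower half-planes. There are circles $\Gamma_+$ and $\Gamma_-$ that, together with their interiors, lie in the open upper and the open lower half-plane respectively, and that contain $\sigma_+$ and $\sigma_-$ respectively in their interiors. For all such circles, positively oriented, $$Jv=(E_+v)\,\mathsf i+(E_-v)(-\mathsf i)\quad(v\in V),\qquad E_\pm=\frac1{2\pi\mathsf i}\int_{\Gamma_\pm}(z\mathcal I_{V_{\mathsf i}}-T)^{-1}\,dz ,$$ that is, $J$ is built from the Riesz projections $E_\pm$ of $T$ on $V_{\mathsf i}$ associated with $\sigma_\pm$. -/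

import Mathlib

open scoped Quaternion MeasureTheory

noncomputable section

namespace QuatSpectral

/-! ### Quaternions, spheres, axially symmetric Borel sets -/

/-- The sphere of normalized purely imaginary quaternions. -/
def imagUnits : Set ℍ := {x | x.re = 0 ∧ ‖x‖ = 1}

/-- The sphere `[x] = {x₀ + i x₁ : i an imaginary unit}`, where `x₀ = Re x` and `x₁ = |Im x|`. -/
def sphereOf (x : ℍ) : Set ℍ :=
  {y | ∃ i ∈ imagUnits, y = ((x.re : ℝ) : ℍ) + i * ((‖x.im‖ : ℝ) : ℍ)}

def IsAxiallySymmetric (U : Set ℍ) : Prop := ∀ x ∈ U, sphereOf x ⊆ U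

theorem mem_sphereOf_iff {x y : ℍ} :
    y ∈ sphereOf x ↔ y.re = x.re ∧ ‖y.im‖ = ‖x.im‖ := by
  constructor
  · rintro ⟨i, ⟨hi0, hi1⟩, rfl⟩
    have him : i.im = i := by
      ext <;> simp [hi0]
    have h2 : (((x.re : ℝ) : ℍ) + i * ((‖x.im‖ : ℝ) : ℍ)).im = ‖x.im‖ • i := by
      ext <;> simp [hi0, mul_comm]
    refine ⟨by simp [hi0], ?_⟩
    rw [h2, norm_smul, hi1]
    simp
  · rintro ⟨h0, h1⟩
    by_cases hx : ‖x.im‖ = 0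
    · let e : ℍ := ⟨0, 1, 0, 0⟩
      refine ⟨e, ⟨rfl, ?_⟩, ?_⟩
      · have h : ‖e‖ * ‖e‖ = 1 := by
          rw [← Quaternion.normSq_eq_norm_mul_self, Quaternion.normSq_def']
          norm_num [e]
        nlinarith [norm_nonneg e]
      · have hy : y.im = 0 := by rw [← norm_eq_zero, h1, hx]
        have := Quaternion.re_add_im y
        rw [hy, add_zero, h0] at this
        rw [hx, ← this]
        simp
    · refine ⟨(‖x.im‖)⁻¹ • y.im, ⟨by simp, ?_⟩, ?_⟩
      · rw [norm_smul, h1, norm_inv, norm_norm, inv_mul_cancel₀ hx]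
      · have : ((‖x.im‖)⁻¹ • y.im) * ((‖x.im‖ : ℝ) : ℍ) = y.im := by
          rw [Quaternion.mul_coe_eq_smul, smul_smul, mul_inv_cancel₀ hx, one_smul]
        rw [this, ← h0, Quaternion.re_add_im]

/-- The sigma-algebra of axially symmetric Borel subsets of `ℍ`. -/
@[reducible] def axialBorel : MeasurableSpace ℍ where
  MeasurableSet' Δ := MeasurableSet[borel ℍ] Δ ∧ IsAxiallySymmetric Δ
  measurableSet_empty := ⟨@MeasurableSet.empty _ (borel ℍ), fun _ hx => hx.elim⟩
  measurableSet_compl Δ h := by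
    refine ⟨@MeasurableSet.compl _ _ (borel ℍ) h.1, fun x hx y hy hyΔ => hx ?_⟩
    obtain ⟨h0, h1⟩ := mem_sphereOf_iff.1 hy
    exact h.2 y hyΔ (mem_sphereOf_iff.2 ⟨h0.symm, h1.symm⟩)
  measurableSet_iUnion Δ h := by
    refine ⟨@MeasurableSet.iUnion _ _ (borel ℍ) _ _ fun n => (h n).1, fun x hx => ?_⟩
    obtain ⟨n, hn⟩ := Set.mem_iUnion.1 hx
    exact ((h n).2 x hn).trans (Set.subset_iUnion Δ n)

/-- The real axis inside `ℍ`. -/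
def realAxis : Set ℍ := Set.range ((↑) : ℝ → ℍ)

theorem mem_realAxis_iff {x : ℍ} : x ∈ realAxis ↔ x.im = 0 := by
  constructor
  · rintro ⟨r, rfl⟩
    simp
  · intro h
    refine ⟨x.re, ?_⟩
    have := Quaternion.re_add_im x
    rwa [h, add_zero] at this

theorem measurableSet_realAxis : MeasurableSet[axialBorel] realAxis := by
  refine ⟨?_, fun x hx y hy => ?_⟩
  · have h : realAxis = (fun x : ℍ => x.im) ⁻¹' {0} := by
      ext x
      exact mem_realAxis_iff
    have hc : IsClosed realAxis := by
      rw [h]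
      exact isClosed_singleton.preimage Quaternion.continuous_im
    let _ : MeasurableSpace ℍ := borel ℍ
    have : BorelSpace ℍ := ⟨rfl⟩
    exact hc.measurableSet
  · rw [mem_realAxis_iff] at hx ⊢
    have := (mem_sphereOf_iff.1 hy).2
    rwa [hx, norm_zero, norm_eq_zero] at this

/-! ### Bounded right linear operators

A quaternionic right Banach space is a complete normed space `V` with a scalar action of `ℍᵐᵒᵖ`
satisfying `‖v a‖ = ‖v‖ |a|`; here `v a` is `MulOpposite.op a • v`.  The real structure is the
restriction of the quaternionic one (`IsScalarTower ℝ ℍᵐᵒᵖ V`).  Bounded right linear operators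
are the continuous `ℍᵐᵒᵖ`-linear maps. -/

section Operators

variable {V : Type*} [NormedAddCommGroup V] [NormedSpace ℝ V] [Module ℍᵐᵒᵖ V]
  [IsScalarTower ℝ ℍᵐᵒᵖ V]

/-- `Q_s(T) = T² - 2 Re(s) T + |s|² I`. -/
def Q (T : V →L[ℍᵐᵒᵖ] V) (s : ℍ) : V →L[ℍᵐᵒᵖ] V :=
  T ^ 2 - (2 * s.re) • T + (‖s‖ ^ 2) • (1 : V →L[ℍᵐᵒᵖ] V)

/-- The `S`-resolvent set: those `s` for which `Q_s(T)` has a bounded right linear inverse. -/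
def sResolventSet (T : V →L[ℍᵐᵒᵖ] V) : Set ℍ := {s | IsUnit (Q T s)}

/-- The `S`-spectrum. -/
def sSpectrum (T : V →L[ℍᵐᵒᵖ] V) : Set ℍ := (sResolventSet T)ᶜ

theorem mapsTo_range_of_commute {W : Type*} [NormedAddCommGroup W] [Module ℍᵐᵒᵖ W]
    {P A : W →L[ℍᵐᵒᵖ] W} (h : Commute P A) :
    Set.MapsTo A (P : W →ₗ[ℍᵐᵒᵖ] W).range (P : W →ₗ[ℍᵐᵒᵖ] W).range := by
  rintro _ ⟨v, rfl⟩
  exact ⟨A v, DFunLike.congr_fun h.eq v⟩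

/-- The restriction `A|_{ran P}` of `A` to the range of an operator `P` commuting with it, as an
operator on `ran P`. -/
def restrictRange {W : Type*} [NormedAddCommGroup W] [Module ℍᵐᵒᵖ W]
    (P A : W →L[ℍᵐᵒᵖ] W) (h : Commute P A) :
    (P : W →ₗ[ℍᵐᵒᵖ] W).range →L[ℍᵐᵒᵖ] (P : W →ₗ[ℍᵐᵒᵖ] W).range :=
  A.restrict (mapsTo_range_of_commute h)

/-! ### Spectral measures, imaginary operators, spectral decompositions -/

/-- Quaternionic spectral measures.  Only the values of `E` on the axially symmetric Borel sets
matter. -/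
structure IsSpectralMeasure (E : Set ℍ → (V →L[ℍᵐᵒᵖ] V)) : Prop where
  idem : ∀ Δ, MeasurableSet[axialBorel] Δ → IsIdempotentElem (E Δ)
  bounded : ∃ K : ℝ, 0 < K ∧ ∀ Δ, MeasurableSet[axialBorel] Δ → ∀ v, ‖E Δ v‖ ≤ K * ‖v‖
  empty : E ∅ = 0
  univ : E Set.univ = 1
  inter : ∀ Δ₁ Δ₂, MeasurableSet[axialBorel] Δ₁ → MeasurableSet[axialBorel] Δ₂ →
    E (Δ₁ ∩ Δ₂) = E Δ₁ * E Δ₂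
  iUnion : ∀ Δ : ℕ → Set ℍ, (∀ n, MeasurableSet[axialBorel] (Δ n)) →
    Pairwise (Function.onFun Disjoint Δ) → ∀ v,
      Filter.Tendsto (fun N => ∑ n ∈ Finset.range N, E (Δ n) v) Filter.atTop
        (nhds (E (⋃ n, Δ n) v))

/-- `J` is imaginary if `-J²` is the projection onto `ran J` along `ker J`. -/
structure IsImaginary (J : V →L[ℍᵐᵒᵖ] V) : Prop where
  idem : IsIdempotentElem (-(J ^ 2))
  range_eq : (↑(-(J ^ 2)) : V →ₗ[ℍᵐᵒᵖ] V).range = (J : V →ₗ[ℍᵐᵒᵖ] V).range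
  ker_eq : (↑(-(J ^ 2)) : V →ₗ[ℍᵐᵒᵖ] V).ker = (J : V →ₗ[ℍᵐᵒᵖ] V).ker

structure IsSpectralSystem (E : Set ℍ → (V →L[ℍᵐᵒᵖ] V)) (J : V →L[ℍᵐᵒᵖ] V) : Prop where
  measure : IsSpectralMeasure E
  imaginary : IsImaginary J
  comm : ∀ Δ, MeasurableSet[axialBorel] Δ → Commute (E Δ) J
  compl_real : E realAxisᶜ = -(J ^ 2)

/-- `E` is a spectral resolution for `T`: a spectral measure commuting with `T` such that the
`S`-spectrum of `T|_{ran E(Δ)}` lies in the closure of `Δ`. -/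
structure IsSpectralResolution (T : V →L[ℍᵐᵒᵖ] V) (E : Set ℍ → (V →L[ℍᵐᵒᵖ] V)) : Prop where
  measure : IsSpectralMeasure E
  comm : ∀ Δ, MeasurableSet[axialBorel] Δ → Commute (E Δ) T
  spectrum_subset : ∀ Δ (hΔ : MeasurableSet[axialBorel] Δ),
    sSpectrum (restrictRange (E Δ) T (comm Δ hΔ)) ⊆ closure Δ

theorem IsSpectralSystem.commute_sub {T J : V →L[ℍᵐᵒᵖ] V} {E : Set ℍ → (V →L[ℍᵐᵒᵖ] V)}
    (h : IsSpectralSystem E J) (hT : IsSpectralResolution T E) (s₀ s₁ : ℝ) :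
    Commute (E realAxisᶜ) (s₀ • (1 : V →L[ℍᵐᵒᵖ] V) - s₁ • J - T) := by
  have hm : MeasurableSet[axialBorel] realAxisᶜ :=
    @MeasurableSet.compl _ _ axialBorel measurableSet_realAxis
  have hJ : Commute (E realAxisᶜ) (s₁ • J) := by
    have := (h.comm _ hm).eq
    ext v
    have hv := DFunLike.congr_fun this v
    have hs : ∀ w, E realAxisᶜ (s₁ • w) = s₁ • E realAxisᶜ w := fun w => by
      rw [← smul_one_smul ℍᵐᵒᵖ s₁ w, map_smul, smul_one_smul]
    change E realAxisᶜ (s₁ • J v) = s₁ • J (E realAxisᶜ v)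
    rw [hs]
    exact congrArg (s₁ • ·) hv
  have h1 : Commute (E realAxisᶜ) (s₀ • (1 : V →L[ℍᵐᵒᵖ] V)) := by
    ext v
    simp
  exact (h1.sub_right hJ).sub_right (hT.comm _ hm)

/-- `(E, J)` is a spectral decomposition for `T`: a spectral system commuting with `T` such that
`E` is a spectral resolution for `T` and `((s₀ I - s₁ J) - T)|_{V₁}` has a bounded inverse on
`V₁ = ran E(ℍ \ ℝ)` for all real `s₀` and all `s₁ > 0`.  Then `J` is a spectral orientation
of `T`. -/
structure IsSpectralDecomposition (T : V →L[ℍᵐᵒᵖ] V) (E : Set ℍ → (V →L[ℍᵐᵒᵖ] V))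
    (J : V →L[ℍᵐᵒᵖ] V) : Prop where
  system : IsSpectralSystem E J
  resolution : IsSpectralResolution T E
  comm : Commute T J
  inverse : ∀ s₀ s₁ : ℝ, 0 < s₁ →
    IsUnit (restrictRange (E realAxisᶜ) (s₀ • (1 : V →L[ℍᵐᵒᵖ] V) - s₁ • J - T)
      (system.commute_sub resolution s₀ s₁))

end Operators

/-! ### The complex Banach space `V_{R,i}` -/

theorem imagUnits_mul_self {i : ℍ} (hi : i ∈ imagUnits) : i * i = -1 := by
  have h1 : star i = -i := by
    ext <;> simp [hi.1]
  have h2 : i * star i = 1 := by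
    rw [Quaternion.self_mul_star, Quaternion.normSq_eq_norm_mul_self, hi.2]
    simp
  rw [h1, mul_neg] at h2
  rw [← h2, neg_neg]

/-- The embedding `x + iy ↦ x + 𝗂 y` of `ℂ` onto the complex plane of the imaginary unit `𝗂`. -/
def planeHom (i : imagUnits) : ℂ →ₐ[ℝ] ℍᵐᵒᵖ :=
  Complex.lift ⟨MulOpposite.op (i : ℍ), by
    rw [← MulOpposite.op_mul, imagUnits_mul_self i.2, MulOpposite.op_neg, MulOpposite.op_one]⟩

theorem planeHom_apply (i : imagUnits) (z : ℂ) :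
    planeHom i z = MulOpposite.op ((z.re : ℍ) + (i : ℍ) * (z.im : ℍ)) := by
  rw [planeHom, Complex.lift_apply, Complex.liftAux_apply]
  apply MulOpposite.unop_injective
  rw [MulOpposite.unop_op, MulOpposite.unop_add, MulOpposite.unop_smul, MulOpposite.unop_op,
    Quaternion.mul_coe_eq_smul]
  rfl

theorem norm_planeHom (i : imagUnits) (z : ℂ) : ‖planeHom i z‖ = ‖z‖ := by
  have hi := i.2.1
  have hn : Quaternion.normSq (i : ℍ) = 1 := by
    rw [Quaternion.normSq_eq_norm_mul_self, i.2.2, mul_one]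
  rw [Quaternion.normSq_def'] at hn
  rw [planeHom_apply, MulOpposite.norm_op, ← sq_eq_sq₀ (norm_nonneg _) (norm_nonneg _), sq,
    ← Quaternion.normSq_eq_norm_mul_self, Complex.sq_norm, Complex.normSq_apply,
    Quaternion.normSq_def']
  simp [hi] at hn ⊢
  nlinarith

/-- `V_{R,i}`: the space `V` with the right scalar multiplication restricted to the complex plane
of the imaginary unit `i`. -/
@[nolint unusedArguments]
def SliceSpace (_i : imagUnits) (V : Type*) : Type _ := V

instance (i : imagUnits) (V : Type*) [NormedAddCommGroup V] :
    NormedAddCommGroup (SliceSpace i V) := inferInstanceAs (NormedAddCommGroup V)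

instance (i : imagUnits) (V : Type*) [NormedAddCommGroup V] [CompleteSpace V] :
    CompleteSpace (SliceSpace i V) := inferInstanceAs (CompleteSpace V)

instance (i : imagUnits) (V : Type*) [NormedAddCommGroup V] [Module ℍᵐᵒᵖ V] :
    Module ℂ (SliceSpace i V) := Module.compHom V (planeHom i : ℂ →+* ℍᵐᵒᵖ)

instance (i : imagUnits) (V : Type*) [NormedAddCommGroup V] [Module ℍᵐᵒᵖ V]
    [NormSMulClass ℍᵐᵒᵖ V] : NormedSpace ℂ (SliceSpace i V) where
  norm_smul_le z v := by
    have h := norm_smul (planeHom i z) (show V from v)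
    rw [norm_planeHom] at h
    exact h.le

/-- A bounded right linear operator `T`, considered as a bounded complex linear operator on
`V_{R,i}`. -/
def sliceOp {V : Type*} [NormedAddCommGroup V] [Module ℍᵐᵒᵖ V] (i : imagUnits)
    (T : V →L[ℍᵐᵒᵖ] V) : SliceSpace i V →L[ℂ] SliceSpace i V where
  toFun v := T v
  map_add' u v := T.map_add u v
  map_smul' z v := T.map_smul (planeHom i z) v
  cont := T.continuous

/-! ### Riesz projections -/

/-- `(2πi)⁻¹ ∮_{|z-c|=r} (z - a)⁻¹ dz`, the circle being positively oriented.  If the circle does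
not meet the spectrum of `a`, this is the Riesz projection of `a` associated with the part of the
spectrum inside the circle. -/
def rieszProj {A : Type*} [NormedRing A] [NormedAlgebra ℂ A] (a : A) (c : ℂ) (r : ℝ) : A :=
  (2 * Real.pi * Complex.I : ℂ)⁻¹ • circleIntegral (fun z => resolvent a z) c r

/-- The circle lies in the open upper half-plane and surrounds the part of the spectrum of `a`
in the open upper half-plane. -/
def SurroundsUpper {A : Type*} [NormedRing A] [NormedAlgebra ℂ A] (a : A) (c : ℂ) (r : ℝ) :
    Prop :=
  0 < r ∧ Metric.closedBall c r ⊆ {z | 0 < z.im} ∧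
    spectrum ℂ a ∩ {z | 0 < z.im} ⊆ Metric.ball c r

/-- The circle lies in the open lower half-plane and surrounds the part of the spectrum of `a`
in the open lower half-plane. -/
def SurroundsLower {A : Type*} [NormedRing A] [NormedAlgebra ℂ A] (a : A) (c : ℂ) (r : ℝ) :
    Prop :=
  0 < r ∧ Metric.closedBall c r ⊆ {z | z.im < 0} ∧
    spectrum ℂ a ∩ {z | z.im < 0} ⊆ Metric.ball c r

end QuatSpectral

end

/-! Since `T - t` is invertible for real `t`, an operator equal to `i` on the upper and `-i` on the
lower part of the spectrum can be written as a real integral. For `x = tan α` the fraction `cayley x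
θ` is `cot (α - θ)`, and its mean over one period is `-i` or `i` according to the half-plane of `x`;
`orientation x` is minus this mean. The addition theorem for the cotangent gives `orientation x ^ 2
= -1` (`OffReal.orientation_sq`), and a difference formula gives the invertibility of `s₀ - s₁ J -
T` (`OffReal.isUnit_sub_sub`). The integral is taken in the bicommutant of `T` among the real linear
operators. Hence `J` commutes with whatever commutes with `T`: with the right multiplications, so
that it is right linear, and with every `E Δ`.

On `ran E(ℝ)` the S-spectrum of `T` is empty, so this range is zero and `E(ℍ \ ℝ) = 1`
(`IsSpectralResolution.realAxis_eq_zero`). Every spectral orientation is therefore a complex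
structure on all of `V`.

For uniqueness, let `j` be any such structure on the complex space `V_i`. The ranges of `(1 - ij)/2`
and `(1 + ij)/2` reduce `T`, and invertibility of `s₀ - s₁ j - T` puts the spectrum of `T` on them
into the upper and lower half-plane. So these are the Riesz projections (`rieszProj_eq`), which do
not depend on `j`. -/

open scoped Quaternion MeasureTheory

noncomputable section

namespace QuatSpectral

/-! ### The orientation in a commutative real Banach algebra -/

section Cayley

variable {C : Type*} [NormedCommRing C] [NormedAlgebra ℝ C]

/-- `x` has no real spectral values. -/
def OffReal (x : C) : Prop := ∀ t : ℝ, IsUnit (x - algebraMap ℝ C t)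

/-- The denominator of `cayley`. -/
def cayleyDen (x : C) (θ : ℝ) : C :=
  algebraMap ℝ C (Real.cos θ) * x - algebraMap ℝ C (Real.sin θ)

/-- The Möbius rotation `(cos θ + x sin θ) / (x cos θ - sin θ)`. -/
def cayley (x : C) (θ : ℝ) : C :=
  (algebraMap ℝ C (Real.cos θ) + algebraMap ℝ C (Real.sin θ) * x) * Ring.inverse (cayleyDen x θ)

/-- `-π⁻¹ ∫₀^π (cos θ + x sin θ) / (x cos θ - sin θ) dθ`, which is `± i` on the parts of the
spectrum of `x` in the upper and lower half-plane. -/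
def orientation (x : C) : C := (-(Real.pi)⁻¹) • ∫ θ in (0 : ℝ)..Real.pi, cayley x θ

theorem OffReal.isUnit_cayleyDen {x : C} (hx : OffReal x) (θ : ℝ) : IsUnit (cayleyDen x θ) := by
  rw [cayleyDen]
  -- Where `cos θ = 0`, the real point `tan θ` is infinite and the denominator is a nonzero scalar.
  by_cases hc : Real.cos θ = 0
  · have hs : Real.sin θ ≠ 0 := fun hs => by
      have := Real.sin_sq_add_cos_sq θ
      simp [hc, hs] at this
    rw [hc, map_zero, zero_mul, zero_sub]
    exact ((isUnit_iff_ne_zero.2 hs).map (algebraMap ℝ C)).neg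
  · have h : algebraMap ℝ C (Real.cos θ) * x - algebraMap ℝ C (Real.sin θ) =
        algebraMap ℝ C (Real.cos θ) * (x - algebraMap ℝ C (Real.sin θ / Real.cos θ)) := by
      rw [mul_sub, ← map_mul, mul_div_cancel₀ _ hc]
    rw [h]
    exact ((isUnit_iff_ne_zero.2 hc).map (algebraMap ℝ C)).mul (hx _)

theorem OffReal.cayleyDen_mul_inverse {x : C} (hx : OffReal x) (θ : ℝ) :
    cayleyDen x θ * Ring.inverse (cayleyDen x θ) = 1 :=
  Ring.mul_inverse_cancel _ (hx.isUnit_cayleyDen θ)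

theorem algebraMap_sin_sq_add_cos_sq (θ : ℝ) :
    algebraMap ℝ C (Real.sin θ) ^ 2 + algebraMap ℝ C (Real.cos θ) ^ 2 = 1 := by
  rw [← map_pow, ← map_pow, ← map_add, Real.sin_sq_add_cos_sq, map_one]

theorem continuous_cayleyDen (x : C) : Continuous (cayleyDen x) := by
  have := continuous_algebraMap ℝ C
  unfold cayleyDen
  fun_prop

theorem OffReal.continuous_inverse [CompleteSpace C] {x : C} (hx : OffReal x) :
    Continuous fun θ => Ring.inverse (cayleyDen x θ) := by
  rw [continuous_iff_continuousAt]
  intro θ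
  obtain ⟨u, hu⟩ := hx.isUnit_cayleyDen θ
  have h := NormedRing.inverse_continuousAt u
  rw [hu] at h
  exact ContinuousAt.comp (f := cayleyDen x) h (continuous_cayleyDen x).continuousAt

theorem OffReal.continuous_cayley [CompleteSpace C] {x : C} (hx : OffReal x) :
    Continuous (cayley x) := by
  have := continuous_algebraMap ℝ C
  have := hx.continuous_inverse
  unfold cayley
  fun_prop

theorem ringInverse_eq_of_mul_eq_one {R : Type*} [CommRing R] {a b : R} (h : a * b = 1) :
    Ring.inverse a = b := by
  rw [← mul_one (Ring.inverse a), ← h, ← mul_assoc,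
    Ring.inverse_mul_cancel _ (IsUnit.of_mul_eq_one b h), one_mul]

theorem intervalIntegral_mul_left [CompleteSpace C] (y : C) {f : ℝ → C} (hf : Continuous f)
    (a b : ℝ) : ∫ θ in a..b, y * f θ = y * ∫ θ in a..b, f θ :=
  (ContinuousLinearMap.mul ℝ C y).intervalIntegral_comp_comm (hf.intervalIntegrable a b)

/-- The period is `π` and not just `2π`, because numerator and denominator both change sign. So
integrals over `[0, π]` are invariant under translation. -/
theorem OffReal.periodic_cayley {x : C} (hx : OffReal x) : Function.Periodic (cayley x) Real.pi := by
  intro θ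
  have h : cayleyDen x (θ + Real.pi) = -cayleyDen x θ := by
    simp [cayleyDen, Real.cos_add_pi, Real.sin_add_pi]
    ring
  rw [cayley, cayley, h, ringInverse_eq_of_mul_eq_one (b := -Ring.inverse (cayleyDen x θ))
    (by rw [neg_mul_neg, hx.cayleyDen_mul_inverse]), Real.cos_add_pi, Real.sin_add_pi,
    map_neg, map_neg]
  ring

/-- The addition theorem. -/
theorem OffReal.sin_mul_cayley_mul_cayley {x : C} (hx : OffReal x) (θ φ : ℝ) :
    algebraMap ℝ C (Real.sin φ) * (cayley x θ * cayley x (θ + φ)) =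
      -algebraMap ℝ C (Real.sin φ) +
        algebraMap ℝ C (Real.cos φ) * (cayley x (θ + φ) - cayley x θ) := by
  have h1 := hx.cayleyDen_mul_inverse θ
  have h2 := hx.cayleyDen_mul_inverse (θ + φ)
  have hs : Real.sin φ = Real.sin (θ + φ) * Real.cos θ - Real.cos (θ + φ) * Real.sin θ := by
    rw [← Real.sin_sub]; ring_nf
  have hc : Real.cos φ = Real.cos (θ + φ) * Real.cos θ + Real.sin (θ + φ) * Real.sin θ := by
    rw [← Real.cos_sub]; ring_nf
  rw [hs, hc, cayley, cayley]
  simp only [cayleyDen, map_sub, map_add, map_mul] at h1 h2 ⊢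
  generalize Ring.inverse (_ : C) = u at h1 ⊢
  generalize Ring.inverse (_ : C) = v at h2 ⊢
  generalize algebraMap ℝ C (Real.sin (θ + φ)) = s' at *
  generalize algebraMap ℝ C (Real.cos (θ + φ)) = c' at *
  generalize algebraMap ℝ C (Real.sin θ) = s at *
  generalize algebraMap ℝ C (Real.cos θ) = c at *
  -- With numerators `N, N'` and denominators `D, D'`, one has `N N' + D D' = cos φ (1 + x²)` and
  -- `N' D - N D' = sin φ (1 + x²)`. The coefficients divide the resulting identity by `D D'`.
  linear_combination (-(s' * c - c' * s) * (c' * x - s') * v +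
    (c' * c + s' * s) * (c' + s' * x) * v) * h1 +
    (-(s' * c - c' * s) - (c' * c + s' * s) * (c + s * x) * u) * h2

/-- Dividing the addition theorem by `sin φ` leaves `-1` plus a multiple of a difference of
translates, whose integral over a period vanishes. -/
theorem OffReal.integral_cayley_mul_cayley [CompleteSpace C] {x : C} (hx : OffReal x) {φ : ℝ}
    (hφ : Real.sin φ ≠ 0) :
    ∫ θ in (0 : ℝ)..Real.pi, cayley x θ * cayley x (θ + φ) = -algebraMap ℝ C Real.pi := by
  have hc := hx.continuous_cayley
  have hc' : Continuous fun θ => cayley x (θ + φ) := hc.comp (continuous_add_const φ)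
  have h0 : ∫ θ in (0 : ℝ)..Real.pi, (cayley x (θ + φ) - cayley x θ) = 0 := by
    rw [intervalIntegral.integral_sub (hc'.intervalIntegrable _ _) (hc.intervalIntegrable _ _),
      intervalIntegral.integral_comp_add_right (fun θ => cayley x θ) φ, sub_eq_zero, zero_add]
    have := hx.periodic_cayley.intervalIntegral_add_eq φ 0
    rwa [add_comm φ, zero_add] at this

  have h : ∀ θ, cayley x θ * cayley x (θ + φ) =
      algebraMap ℝ C (-1) + (Real.cos φ / Real.sin φ) • (cayley x (θ + φ) - cayley x θ) := by
    intro θ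
    have h1 := hx.sin_mul_cayley_mul_cayley θ φ
    have h2 : algebraMap ℝ C (Real.sin φ)⁻¹ * algebraMap ℝ C (Real.sin φ) = 1 := by
      rw [← map_mul, inv_mul_cancel₀ hφ, map_one]
    rw [Algebra.smul_def, div_eq_mul_inv, map_mul, map_neg, map_one]
    linear_combination algebraMap ℝ C (Real.sin φ)⁻¹ * h1 -
      (cayley x θ * cayley x (θ + φ) + 1) * h2
  simp_rw [h]
  rw [intervalIntegral.integral_add (by simp) ((by fun_prop : Continuous fun θ =>
      (Real.cos φ / Real.sin φ) • (cayley x (θ + φ) - cayley x θ)).intervalIntegrable _ _),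
    intervalIntegral.integral_smul, h0, intervalIntegral.integral_const]
  rw [smul_zero, add_zero, sub_zero, Algebra.smul_def, ← map_mul, mul_neg_one, map_neg]

/-- By periodicity the product is the double integral of `cayley x θ * cayley x (θ + φ)`. After
Fubini the integral over `θ` is the constant `-π` for all `φ` in the open interval, where `sin φ ≠
0`. -/
theorem OffReal.integral_cayley_sq [CompleteSpace C] {x : C} (hx : OffReal x) :
    (∫ θ in (0 : ℝ)..Real.pi, cayley x θ) * (∫ θ in (0 : ℝ)..Real.pi, cayley x θ) =
      -algebraMap ℝ C (Real.pi ^ 2) := by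
  have hc := hx.continuous_cayley
  have hF : Continuous (Function.uncurry fun φ θ : ℝ => cayley x θ * cayley x (θ + φ)) := by
    unfold Function.uncurry
    fun_prop
  have h1 : ∫ φ in (0 : ℝ)..Real.pi, ∫ θ in (0 : ℝ)..Real.pi, cayley x θ * cayley x (θ + φ) =
      -algebraMap ℝ C (Real.pi ^ 2) := by
    rw [intervalIntegral.integral_congr_Ioo_of_le (g := fun _ => -algebraMap ℝ C Real.pi)
      Real.pi_pos.le fun φ hφ => hx.integral_cayley_mul_cayley (Real.sin_pos_of_mem_Ioo hφ).ne']
    rw [intervalIntegral.integral_const, sub_zero, Algebra.smul_def, mul_neg, ← map_mul, sq]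
  rw [MeasureTheory.intervalIntegral_intervalIntegral_swap
    ((hF.continuousOn.integrableOn_compact (isCompact_uIcc.prod isCompact_uIcc)).mono_set
      (Set.prod_mono Set.uIoc_subset_uIcc Set.uIoc_subset_uIcc))] at h1
  rw [← h1, ← intervalIntegral_mul_left _ hc]
  refine intervalIntegral.integral_congr fun θ _ => ?_
  rw [intervalIntegral_mul_left _ (f := fun φ => cayley x (θ + φ))
      (hc.comp (continuous_const_add θ)), mul_comm (cayley x θ),
    intervalIntegral.integral_comp_add_left (fun φ => cayley x φ) θ, add_zero]
  have := hx.periodic_cayley.intervalIntegral_add_eq θ 0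
  rw [zero_add] at this
  rw [this]

theorem integral_cayley (x : C) :
    ∫ θ in (0 : ℝ)..Real.pi, cayley x θ = (-Real.pi) • orientation x := by
  rw [orientation, smul_smul, neg_mul_neg, mul_inv_cancel₀ Real.pi_ne_zero, one_smul]

theorem OffReal.orientation_sq [CompleteSpace C] {x : C} (hx : OffReal x) :
    orientation x * orientation x = -1 := by
  rw [orientation, smul_mul_smul_comm, hx.integral_cayley_sq, smul_neg, Algebra.smul_def, ← map_mul,
    neg_mul_neg, ← sq, ← mul_pow, inv_mul_cancel₀ Real.pi_ne_zero, one_pow, map_one]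

/-- Difference of two values of `orientation`. -/
theorem OffReal.exists_orientation_sub [CompleteSpace C] {x w : C} (hx : OffReal x)
    (hw : OffReal w) : ∃ y, orientation x - orientation w = (w - x) * y := by
  have hcx := hx.continuous_cayley
  have hcw := hw.continuous_cayley
  refine ⟨(-(Real.pi)⁻¹) • ∫ θ in (0 : ℝ)..Real.pi,
    Ring.inverse (cayleyDen x θ) * Ring.inverse (cayleyDen w θ), ?_⟩
  rw [orientation, orientation, ← smul_sub,
    ← intervalIntegral.integral_sub (hcx.intervalIntegrable _ _) (hcw.intervalIntegrable _ _),
    mul_smul_comm, ← intervalIntegral_mul_left _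
      (f := fun θ => Ring.inverse (cayleyDen x θ) * Ring.inverse (cayleyDen w θ))
      (hx.continuous_inverse.mul hw.continuous_inverse)]
  congr 1
  refine intervalIntegral.integral_congr fun θ _ => ?_
  have h1 := hx.cayleyDen_mul_inverse θ
  have h2 := hw.cayleyDen_mul_inverse θ
  have h3 := algebraMap_sin_sq_add_cos_sq (C := C) θ
  simp only [cayley]
  simp only [cayleyDen] at h1 h2 ⊢
  generalize Ring.inverse (_ : C) = u at h1 ⊢
  generalize Ring.inverse (_ : C) = v at h2 ⊢
  generalize algebraMap ℝ C (Real.sin θ) = s at *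
  generalize algebraMap ℝ C (Real.cos θ) = c at *
  -- Over the common denominator the numerator of the difference is `(w - x) (sin² θ + cos² θ)`.
  linear_combination (c + s * w) * v * h1 - (c + s * x) * u * h2 + (w - x) * u * v * h3

theorem map_orientation [CompleteSpace C] {C' : Type*} [NormedCommRing C'] [NormedAlgebra ℝ C']
    [CompleteSpace C'] (f : C' →ₐ[ℝ] C) (hf : Continuous f) {x : C'} (hx : OffReal x) :
    orientation (f x) = f (orientation x) := by
  let g : C' →L[ℝ] C := ⟨f.toLinearMap, hf⟩
  have hg : ∀ y, f y = g y := fun _ => rfl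
  have h : ∀ θ, cayley (f x) θ = g (cayley x θ) := by
    intro θ
    have hd : cayleyDen (f x) θ = f (cayleyDen x θ) := by
      simp [cayleyDen]
    have hi : Ring.inverse (f (cayleyDen x θ)) = f (Ring.inverse (cayleyDen x θ)) :=
      ringInverse_eq_of_mul_eq_one (by rw [← map_mul, hx.cayleyDen_mul_inverse, map_one])
    rw [← hg, cayley, cayley, hd, hi]
    simp only [map_mul, map_add, AlgHom.commutes]
  rw [orientation, orientation, funext h, hg, map_smul,
    g.intervalIntegral_comp_comm (hx.continuous_cayley.intervalIntegrable _ _)]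

theorem offReal_complex {z : ℂ} (hz : z.im ≠ 0) : OffReal z := by
  intro t
  rw [isUnit_iff_ne_zero, Ne, sub_eq_zero]
  rintro rfl
  simp at hz

theorem OffReal.map {C' : Type*} [NormedCommRing C'] [NormedAlgebra ℝ C'] (f : C' →ₐ[ℝ] C) {x : C'}
    (hx : OffReal x) : OffReal (f x) := by
  intro t
  have := (hx t).map f
  simpa using this

/-- The real Möbius map has determinant `-1`, so it exchanges the half-planes. -/
theorem im_cayley_nonpos {z : ℂ} (hz : 0 < z.im) (θ : ℝ) : (cayley z θ).im ≤ 0 := by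
  rw [cayley, Ring.inverse_eq_inv', ← div_eq_mul_inv, Complex.div_im, cayleyDen, ← sub_div]
  refine div_nonpos_of_nonpos_of_nonneg ?_ (Complex.normSq_nonneg _)
  simp only [Complex.coe_algebraMap, Complex.add_im, Complex.ofReal_im, Complex.mul_im,
    Complex.ofReal_re, zero_mul, add_zero, zero_add, Complex.sub_re, Complex.mul_re, sub_zero,
    Complex.add_re, Complex.sub_im]
  nlinarith [mul_nonneg hz.le (sq_nonneg (Real.sin θ)), mul_nonneg hz.le (sq_nonneg (Real.cos θ))]

/-- The square being `-1` leaves only `± i`; the sign of the imaginary part of the integrand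
decides. -/
theorem orientation_complex {z : ℂ} (hz : 0 < z.im) : orientation z = Complex.I := by
  have h := (offReal_complex hz.ne').orientation_sq
  have h2 : (orientation z - Complex.I) * (orientation z + Complex.I) = 0 := by
    linear_combination h - Complex.I_sq
  rcases mul_eq_zero.1 h2 with h3 | h3
  · exact sub_eq_zero.1 h3
  · exfalso
    have hc := (offReal_complex hz.ne').continuous_cayley
    have h4 : (∫ θ in (0 : ℝ)..Real.pi, cayley z θ).im = ∫ θ in (0 : ℝ)..Real.pi, (cayley z θ).im :=
      (Complex.imCLM.intervalIntegral_comp_comm (hc.intervalIntegrable _ _)).symm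
    rw [integral_cayley, eq_neg_of_add_eq_zero_left h3] at h4
    have h5 : ∫ θ in (0 : ℝ)..Real.pi, (cayley z θ).im ≤ 0 := by
      have := intervalIntegral.integral_nonneg (μ := MeasureTheory.volume)
        (f := fun θ => -(cayley z θ).im) Real.pi_pos.le
        fun θ _ => neg_nonneg.2 (im_cayley_nonpos hz θ)
      rwa [intervalIntegral.integral_neg, neg_nonneg] at this
    rw [← h4] at h5
    simp at h5
    linarith [Real.pi_pos]

/-- Every element without real spectral values is, with respect to its orientation, an element of
the upper half-plane. -/
theorem OffReal.isUnit_sub_sub [CompleteSpace C] {x : C} (hx : OffReal x) (s₀ : ℝ) {s₁ : ℝ}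
    (hs : 0 < s₁) : IsUnit (s₀ • (1 : C) - s₁ • orientation x - x) := by
  have hj := hx.orientation_sq
  set j := orientation x with hjdef
  -- With `f I = -j`, the element `f z = s₀ - s₁ j` has orientation `-j`, opposite to that of `x`.
  -- The difference formula then reads `2 j = (f z - x) y`, and the left side is invertible.
  let f : ℂ →ₐ[ℝ] C := Complex.lift ⟨-j, by rw [neg_mul_neg, hj]⟩
  have hf : Continuous f := f.toLinearMap.continuous_of_finiteDimensional
  have hI : f Complex.I = -j := by simp [f]
  let z : ℂ := ⟨s₀, s₁⟩
  have hz : f z = s₀ • (1 : C) - s₁ • j := by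
    simp [f, z, Complex.liftAux_apply, Algebra.smul_def, sub_eq_add_neg]
  have hoz := offReal_complex (z := z) hs.ne'
  obtain ⟨y, hy⟩ := hx.exists_orientation_sub (hoz.map f)
  rw [map_orientation f hf hoz, orientation_complex hs, hI, hz, ← hjdef] at hy
  refine IsUnit.of_mul_eq_one (y * (-(1 / 2 : ℝ) • j)) ?_
  rw [← mul_assoc, ← hy, sub_neg_eq_add, ← two_mul, mul_smul_comm, mul_assoc, hj, neg_smul,
    mul_neg_one, smul_neg, neg_neg, Algebra.smul_def, ← map_ofNat (algebraMap ℝ C) 2, ← map_mul]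
  norm_num

end Cayley

/-! ### Orientations in noncommutative real Banach algebras -/

/-- Inverses of elements of a commutant stay in it, so passing to the bicommutant creates no new
real spectral values. -/
theorem isUnit_subalgebra_centralizer {R B : Type*} [CommRing R] [Ring B] [Algebra R B] {s : Set B}
    {b : Subalgebra.centralizer R s} (h : IsUnit (b : B)) : IsUnit b := by
  obtain ⟨u, hu⟩ := h
  have hc : ∀ g ∈ s, Commute g (u : B) := fun g hg => by
    rw [hu]
    exact Subalgebra.mem_centralizer_iff R |>.1 b.2 g hg
  refine isUnit_iff_exists.2
    ⟨⟨↑u⁻¹, (Subalgebra.mem_centralizer_iff R).2 fun g hg => (hc g hg).units_inv_right.eq⟩, ?_, ?_⟩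
  · ext
    simp [← hu]
  · ext
    simp [← hu]

theorem exists_orientation {B : Type*} [NormedRing B] [NormedAlgebra ℝ B] [CompleteSpace B] {x : B}
    (hx : ∀ t : ℝ, IsUnit (x - t • (1 : B))) :
    ∃ j : B, (∀ y, Commute y x → Commute y j) ∧ j * j = -1 ∧
      ∀ s₀ s₁ : ℝ, 0 < s₁ → IsUnit (s₀ • (1 : B) - s₁ • j - x) := by
  let Z : Set B := Set.centralizer {x}
  let C := Subalgebra.centralizer ℝ Z
  have hxC : x ∈ C := (Subalgebra.mem_centralizer_iff ℝ).2 fun g hg =>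
    (Set.mem_centralizer_iff.1 hg x rfl).symm
  -- As `x` commutes with itself, the bicommutant lies in the commutant and is therefore
  -- commutative.
  have hCZ : ∀ y ∈ C, y ∈ Z := fun y hy => Set.mem_centralizer_iff.2 fun m hm => by
    rw [Set.mem_singleton_iff.1 hm]
    exact (Subalgebra.mem_centralizer_iff ℝ).1 hy x
      (Set.mem_centralizer_iff.2 fun m hm => by rw [Set.mem_singleton_iff.1 hm])
  let _ : NormedCommRing C :=
    { (inferInstance : NormedRing C) with
      mul_comm := fun a b => Subtype.ext
        ((Subalgebra.mem_centralizer_iff ℝ).1 b.2 a (hCZ a a.2)) }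
  let _ : NormedAlgebra ℝ C := Subalgebra.toNormedAlgebra C
  have : CompleteSpace C := (Set.isClosed_centralizer Z).completeSpace_coe
  have hX : OffReal (⟨x, hxC⟩ : C) := fun t => by
    refine isUnit_subalgebra_centralizer ?_
    have := hx t
    rw [← Algebra.algebraMap_eq_smul_one] at this
    exact this
  refine ⟨(orientation (⟨x, hxC⟩ : C) : C), fun y hy => ?_, ?_, fun s₀ s₁ hs => ?_⟩
  · refine (Subalgebra.mem_centralizer_iff ℝ).1 (orientation (⟨x, hxC⟩ : C)).2 y ?_
    exact Set.mem_centralizer_iff.2 fun m hm => by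
      rw [Set.mem_singleton_iff.1 hm]
      exact hy.symm.eq
  · exact congrArg (Subtype.val : C → B) hX.orientation_sq
  · exact (hX.isUnit_sub_sub s₀ hs).map C.val

/-! ### Right linear operators as real linear operators -/

section RightLinear

variable {V : Type*} [NormedAddCommGroup V] [NormedSpace ℝ V] [Module ℍᵐᵒᵖ V]
  [IsScalarTower ℝ ℍᵐᵒᵖ V]

/-- A bounded right linear operator as a bounded real linear operator. -/
def toReal : (V →L[ℍᵐᵒᵖ] V) →+* (V →L[ℝ] V) where
  toFun A := A.restrictScalars ℝ
  map_one' := rfl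
  map_mul' _ _ := rfl
  map_zero' := rfl
  map_add' _ _ := rfl

@[simp] theorem toReal_apply (A : V →L[ℍᵐᵒᵖ] V) (v : V) : toReal A v = A v := rfl

@[simp] theorem toReal_smul (t : ℝ) (A : V →L[ℍᵐᵒᵖ] V) : toReal (t • A) = t • toReal A := rfl

theorem toReal_injective : Function.Injective (toReal : (V →L[ℍᵐᵒᵖ] V) → (V →L[ℝ] V)) :=
  fun _ _ h => ContinuousLinearMap.ext fun v => DFunLike.congr_fun h v

variable [NormSMulClass ℍᵐᵒᵖ V]

/-- Right multiplication by a quaternion. -/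
def rightMul (q : ℍᵐᵒᵖ) : V →L[ℝ] V where
  toFun v := q • v
  map_add' := smul_add q
  map_smul' t v := by
    rw [RingHom.id_apply, ← smul_one_smul ℍᵐᵒᵖ t v, ← smul_one_smul ℍᵐᵒᵖ t (q • v), smul_smul,
      smul_smul, smul_one_mul, mul_smul_one]
  cont := by
    have : LipschitzWith ‖q‖₊ fun v : V => q • v := LipschitzWith.of_dist_le_mul fun v w => by
      rw [dist_eq_norm, dist_eq_norm, ← smul_sub, norm_smul, coe_nnnorm]
    exact this.continuous

theorem commute_rightMul_toReal (q : ℍᵐᵒᵖ) (A : V →L[ℍᵐᵒᵖ] V) : Commute (rightMul q) (toReal A) := by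
  ext v
  exact (A.map_smul q v).symm

/-- Right linearity is commutation with all right multiplications, so the bicommutant of a right
linear operator consists of right linear operators. -/
theorem exists_toReal_eq {A : V →L[ℝ] V} (h : ∀ q, Commute (rightMul q) A) :
    ∃ B : V →L[ℍᵐᵒᵖ] V, toReal B = A :=
  ⟨{ toFun := A
     map_add' := A.map_add
     map_smul' := fun q v => (DFunLike.congr_fun (h q).eq v).symm
     cont := A.continuous }, rfl⟩

theorem isUnit_of_isUnit_toReal {A : V →L[ℍᵐᵒᵖ] V} (h : IsUnit (toReal A)) : IsUnit A := by
  obtain ⟨u, hu⟩ := h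
  obtain ⟨B, hB⟩ := exists_toReal_eq (A := ((u⁻¹ : (V →L[ℝ] V)ˣ) : V →L[ℝ] V)) fun q =>
    (hu.symm ▸ commute_rightMul_toReal q A : Commute (rightMul q) (u : V →L[ℝ] V)).units_inv_right
  refine isUnit_iff_exists.2 ⟨B, toReal_injective ?_, toReal_injective ?_⟩
  · rw [map_mul, hB, ← hu, Units.mul_inv, map_one]
  · rw [map_mul, hB, ← hu, Units.inv_mul, map_one]

/-- The orientation of an operator without real spectral values. -/
theorem exists_rightLinear_orientation [CompleteSpace V] {T : V →L[ℍᵐᵒᵖ] V}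
    (hT : ∀ t : ℝ, IsUnit (T - t • (1 : V →L[ℍᵐᵒᵖ] V))) :
    ∃ J : V →L[ℍᵐᵒᵖ] V, (∀ A, Commute A T → Commute A J) ∧ J * J = -1 ∧
      ∀ s₀ s₁ : ℝ, 0 < s₁ → IsUnit (s₀ • (1 : V →L[ℍᵐᵒᵖ] V) - s₁ • J - T) := by
  obtain ⟨j, hj, hj2, hu⟩ := exists_orientation (x := toReal T) fun t => by
    simpa using (hT t).map toReal
  obtain ⟨J, rfl⟩ := exists_toReal_eq fun q => hj _ (commute_rightMul_toReal q T)
  refine ⟨J, fun A hA => ?_, toReal_injective ?_, fun s₀ s₁ hs => isUnit_of_isUnit_toReal ?_⟩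
  · have := (hj _ (hA.map toReal)).eq
    rw [← map_mul, ← map_mul] at this
    exact toReal_injective this
  · rw [map_mul, hj2, map_neg, map_one]
  · simpa using hu s₀ s₁ hs

end RightLinear

/-! ### Riesz projections -/

section Riesz

variable {A : Type*} [NormedRing A] [NormedAlgebra ℂ A]

/-- The factor `resolvent a z` on the right tends to zero at infinity, so the difference is
negligible on large circles around `c`. -/
theorem resolvent_sub_inv_smul {a : A} {c z : ℂ} (h : z ∈ resolventSet ℂ a) (hz : z - c ≠ 0) :
    resolvent a z - (z - c)⁻¹ • (1 : A) =
      (z - c)⁻¹ • ((a - algebraMap ℂ A c) * resolvent a z) := by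
  have h1 : (algebraMap ℂ A z - a) * resolvent a z = 1 := Ring.mul_inverse_cancel _ h
  have h2 : (a - algebraMap ℂ A c) * resolvent a z = (z - c) • resolvent a z - 1 := by
    rw [← h1, Algebra.smul_def, ← sub_mul, map_sub]
    congr 1
    abel
  rw [h2, smul_sub, smul_smul, inv_mul_cancel₀ hz, one_smul]

/-- `z - a` is invertible in the corner of `p`. -/
def IsUnitCorner (a p : A) (z : ℂ) : Prop :=
  ∃ b, Commute p b ∧ (algebraMap ℂ A z - a) * b = p ∧ b * (algebraMap ℂ A z - a) = p

theorem commute_algebraMap_sub {a p : A} (hpa : Commute p a) (z : ℂ) :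
    Commute p (algebraMap ℂ A z - a) :=
  Commute.sub_right (Algebra.commutes z p).symm hpa

theorem mem_resolventSet_of_isUnitCorner {a p : A} {z : ℂ} (h : IsUnitCorner a p z)
    (h' : IsUnitCorner a (1 - p) z) : z ∈ resolventSet ℂ a := by
  obtain ⟨b, -, hb, hb'⟩ := h
  obtain ⟨d, -, hd, hd'⟩ := h'
  refine isUnit_iff_exists.2 ⟨b + d, ?_, ?_⟩
  · rw [mul_add, hb, hd, add_sub_cancel]
  · rw [add_mul, hb', hd', add_sub_cancel]

theorem isUnitCorner_of_isUnit {a p : A} {z : ℂ} {x : A} (hx : IsUnit x) (hpa : Commute p a)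
    (hpx : Commute p x) (hxp : x * p = (algebraMap ℂ A z - a) * p) : IsUnitCorner a p z := by
  obtain ⟨u, rfl⟩ := hx
  have hz := commute_algebraMap_sub hpa z
  have hpu : Commute p ↑u⁻¹ := hpx.units_inv_right
  refine ⟨↑u⁻¹ * p, hpu.mul_right (Commute.refl p), ?_, ?_⟩
  · rw [← hpu.eq, ← mul_assoc, ← hxp, ← hpx.eq, mul_assoc, Units.mul_inv, mul_one]
  · rw [mul_assoc, hz.eq, ← hxp, ← mul_assoc, Units.inv_mul, one_mul]

/-- `a` on the corner of the idempotent `p` and the scalar `c` on the other corner. -/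
theorem mem_resolventSet_corner {a p : A} {z c : ℂ} (hp : IsIdempotentElem p) (hpa : Commute p a)
    (h : IsUnitCorner a p z) (hzc : z ≠ c) : z ∈ resolventSet ℂ (a * p + c • (1 - p)) := by
  obtain ⟨b, hpb, hb, hb'⟩ := h
  have hzc' : z - c ≠ 0 := sub_ne_zero.2 hzc
  have hz := commute_algebraMap_sub hpa z
  have h0 : p * (1 - p) = 0 := by rw [mul_sub, mul_one, hp.eq, sub_self]
  have h0' : (1 - p) * p = 0 := by rw [sub_mul, one_mul, hp.eq, sub_self]
  have h1 : (1 - p) * (1 - p) = 1 - p := hp.one_sub.eq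
  have hform : algebraMap ℂ A z - (a * p + c • (1 - p)) =
      (algebraMap ℂ A z - a) * p + (z - c) • (1 - p) := by
    rw [Algebra.algebraMap_eq_smul_one, sub_mul, smul_mul_assoc, one_mul]
    module
  change IsUnit _
  rw [hform]
  refine isUnit_iff_exists.2 ⟨p * b + (z - c)⁻¹ • (1 - p), ?_, ?_⟩
  · have e1 : (algebraMap ℂ A z - a) * p * (p * b) = p := by
      rw [mul_assoc, ← mul_assoc p p b, hp.eq, hpb.eq, ← mul_assoc, hb, hp.eq]
    have e2 : (algebraMap ℂ A z - a) * p * (1 - p) = 0 := by rw [mul_assoc, h0, mul_zero]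
    have e3 : (1 - p) * (p * b) = 0 := by rw [← mul_assoc, h0', zero_mul]
    rw [add_mul, mul_add, mul_add, mul_smul_comm, smul_mul_assoc, smul_mul_assoc, e1, e2, e3,
      mul_smul_comm, h1, smul_smul, mul_inv_cancel₀ hzc']
    simp
  · have e1 : p * b * ((algebraMap ℂ A z - a) * p) = p := by
      rw [mul_assoc, ← mul_assoc b, hb', hp.eq, hp.eq]
    have e2 : (1 - p) * ((algebraMap ℂ A z - a) * p) = 0 := by
      rw [← hz.eq, ← mul_assoc, h0', zero_mul]
    have e3 : p * b * (1 - p) = 0 := by rw [hpb.eq, mul_assoc, h0, mul_zero]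
    rw [add_mul, mul_add, mul_add, mul_smul_comm, smul_mul_assoc, smul_mul_assoc, e1, e2, e3,
      mul_smul_comm, h1, smul_smul, inv_mul_cancel₀ hzc']
    simp

theorem commute_resolvent {a p : A} {z : ℂ} (hpa : Commute p a)
    (h : z ∈ resolventSet ℂ a) : Commute p (resolvent a z) := by
  have h1 : resolvent a z * (algebraMap ℂ A z - a) = 1 := Ring.inverse_mul_cancel _ h
  have h2 : (algebraMap ℂ A z - a) * resolvent a z = 1 := Ring.mul_inverse_cancel _ h
  have hz := commute_algebraMap_sub hpa z
  calc p * resolvent a z = resolvent a z * (algebraMap ℂ A z - a) * (p * resolvent a z) := by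
        rw [h1, one_mul]
    _ = resolvent a z * p * ((algebraMap ℂ A z - a) * resolvent a z) := by
        rw [mul_assoc, ← mul_assoc _ p, ← hz.eq]
        simp only [mul_assoc]
    _ = resolvent a z * p := by rw [h2, mul_one]

/-- This lets `a` be changed on the complementary corner without affecting the contour integral on
the corner of `p`. -/
theorem resolvent_mul_corner {a a' p : A} {z : ℂ} (h : z ∈ resolventSet ℂ a)
    (h' : z ∈ resolventSet ℂ a') (hpa : Commute p a) (hpa' : Commute p a') (haa : p * a = p * a') :
    resolvent a z * p = resolvent a' z * p := by
  have h1 : resolvent a z * (algebraMap ℂ A z - a) = 1 := Ring.inverse_mul_cancel _ h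
  have h2 : (algebraMap ℂ A z - a') * resolvent a' z = 1 := Ring.mul_inverse_cancel _ h'
  have h3 : p * (algebraMap ℂ A z - a') = p * (algebraMap ℂ A z - a) := by
    rw [mul_sub, mul_sub, haa]
  calc resolvent a z * p = resolvent a z * (p * (algebraMap ℂ A z - a')) * resolvent a' z := by
        rw [mul_assoc, mul_assoc, h2, mul_one]
    _ = p * resolvent a' z := by
        rw [h3, (commute_algebraMap_sub hpa z).eq, ← mul_assoc, h1, one_mul]
    _ = resolvent a' z * p := (commute_resolvent hpa' h').eq

/-! ### Contour integrals of the resolvent -/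

variable [CompleteSpace A]

theorem differentiableAt_resolvent {a : A} {z : ℂ} (h : z ∈ resolventSet ℂ a) :
    DifferentiableAt ℂ (resolvent a) z :=
  (spectrum.hasDerivAt_resolvent_const_left h).differentiableAt

theorem circleIntegral_resolvent_eq_zero {a : A} {c : ℂ} {r : ℝ} (hr : 0 < r)
    (h : Metric.closedBall c r ⊆ resolventSet ℂ a) :
    (∮ z in C(c, r), resolvent a z) = 0 :=
  Complex.circleIntegral_eq_zero_of_differentiable_on_off_countable hr.le Set.countable_empty
    (fun _ hz => (differentiableAt_resolvent (h hz)).continuousAt.continuousWithinAt)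
    fun _ hz => differentiableAt_resolvent (h (Metric.ball_subset_closedBall hz.1))

theorem circleIntegrable_resolvent {a : A} {c : ℂ} {r : ℝ} (hr : 0 < r)
    (h : Metric.sphere c r ⊆ resolventSet ℂ a) : CircleIntegrable (resolvent a) c r :=
  ContinuousOn.circleIntegrable hr.le
    fun _ hz => (differentiableAt_resolvent (h hz)).continuousAt.continuousWithinAt

/-- The circle may be enlarged without changing the integral, and on large circles the resolvent is
compared with `(z - c)⁻¹`. -/
theorem circleIntegral_resolvent_eq {a : A} {c : ℂ} {r : ℝ} (hr : 0 < r)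
    (h : spectrum ℂ a ⊆ Metric.ball c r) :
    (∮ z in C(c, r), resolvent a z) = (2 * Real.pi * Complex.I : ℂ) • (1 : A) := by
  have hres : ∀ z, z ∉ Metric.ball c r → z ∈ resolventSet ℂ a := fun z hz => by
    by_contra hz'
    exact hz (h hz')
  have hR : ∀ R, r ≤ R → (∮ z in C(c, R), resolvent a z) = ∮ z in C(c, r), resolvent a z :=
    fun R hrR => Complex.circleIntegral_eq_of_differentiable_on_annulus_off_countable hr hrR
      Set.countable_empty
      (fun z hz => (differentiableAt_resolvent (hres z hz.2)).continuousAt.continuousWithinAt)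
      fun z hz => differentiableAt_resolvent
        (hres z fun hz' => hz.1.2 (Metric.ball_subset_closedBall hz'))
  rw [← sub_eq_zero, ← norm_le_zero_iff]
  refine le_of_forall_pos_le_add fun ε hε => ?_
  rw [zero_add]
  set M := ‖a - algebraMap ℂ A c‖ with hM
  -- The final bound is `ε M / (M + 1)`; the summand `1` covers `M = 0`.
  have hδ : 0 < ε / (2 * Real.pi * (M + 1)) := by positivity
  obtain ⟨R₀, hR₀⟩ : ∃ R₀ : ℝ, ∀ z : ℂ, R₀ ≤ ‖z‖ →
      ‖resolvent a z‖ < ε / (2 * Real.pi * (M + 1)) := by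
    have h1 := (spectrum.resolvent_tendsto_cobounded (𝕜 := ℂ) a).norm
    rw [norm_zero] at h1
    have h2 := h1.eventually_lt_const hδ
    rw [← comap_norm_atTop, Filter.eventually_comap, Filter.eventually_atTop] at h2
    obtain ⟨R₀, h3⟩ := h2
    exact ⟨R₀, fun z hz => h3 _ hz z rfl⟩
  set R := max r (R₀ + ‖c‖) with hRdef
  have hRr : r ≤ R := le_max_left _ _
  have hR0 : 0 < R := hr.trans_le hRr
  have hsph : Metric.sphere c R ⊆ resolventSet ℂ a := fun z hz => hres z fun hz' => by
    rw [Metric.mem_sphere] at hz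
    rw [Metric.mem_ball, hz] at hz'
    exact absurd hz' hRr.not_gt
  have hinv : CircleIntegrable (fun z => (z - c)⁻¹ • (1 : A)) c R := by
    refine ContinuousOn.circleIntegrable hR0.le fun z hz => ContinuousAt.continuousWithinAt ?_
    have : z - c ≠ 0 := fun h0 => by
      rw [Metric.mem_sphere, dist_eq_norm, h0, norm_zero] at hz
      exact hR0.ne hz
    fun_prop (disch := assumption)
  have hI : (∮ z in C(c, R), (z - c)⁻¹ • (1 : A)) = (2 * Real.pi * Complex.I : ℂ) • (1 : A) := by
    rw [circleIntegral.integral_smul_const, circleIntegral.integral_sub_center_inv c hR0.ne']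
  rw [← hR R hRr, ← hI, ← circleIntegral.integral_sub (circleIntegrable_resolvent hR0 hsph) hinv]
  refine (circleIntegral.norm_integral_le_of_norm_le_const hR0.le
    (C := R⁻¹ * (M * (ε / (2 * Real.pi * (M + 1))))) fun z hz => ?_).trans ?_
  · have hn : ‖z - c‖ = R := by rw [← dist_eq_norm]; exact hz
    rw [resolvent_sub_inv_smul (hsph hz) (norm_pos_iff.1 (hn ▸ hR0)), norm_smul, norm_inv, hn]
    refine mul_le_mul_of_nonneg_left ((norm_mul_le _ _).trans ?_) (by positivity)
    refine mul_le_mul_of_nonneg_left (hR₀ z ?_).le (norm_nonneg _)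
    have : ‖z - c‖ ≤ ‖z‖ + ‖c‖ := norm_sub_le _ _
    have : R₀ + ‖c‖ ≤ R := le_max_right _ _
    linarith
  · have : 2 * Real.pi * R * (R⁻¹ * (M * (ε / (2 * Real.pi * (M + 1))))) = ε * (M / (M + 1)) := by
      field_simp
    rw [this]
    have hM1 : M / (M + 1) ≤ 1 := (div_le_one (by positivity)).2 (by linarith)
    nlinarith

theorem circleIntegral_mul_right {f : ℂ → A} {c : ℂ} {r : ℝ} (hf : CircleIntegrable f c r) (p : A) :
    (∮ z in C(c, r), f z * p) = (∮ z in C(c, r), f z) * p := by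
  have h := ((ContinuousLinearMap.mul ℂ A).flip p).intervalIntegral_comp_comm hf.out
  simp only [circleIntegral]
  refine Eq.trans ?_ h
  simp

/-- If the spectrum of `a` in the corner of `p` lies inside a circle and that in the corner of
`1 - p` outside, then `p` is the Riesz projection. -/
theorem rieszProj_eq {a p : A} {c : ℂ} {r : ℝ} (hr : 0 < r) (hp : IsIdempotentElem p)
    (hpa : Commute p a) (hout : ∀ z, z ∉ Metric.ball c r → IsUnitCorner a p z)
    (hin : ∀ z ∈ Metric.closedBall c r, IsUnitCorner a (1 - p) z) : rieszProj a c r = p := by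
  have hp1 : IsIdempotentElem (1 - p) := hp.one_sub
  have hpa1 : Commute (1 - p) a := (Commute.one_left a).sub_left hpa
  have hpp : Commute p (1 - p) := (Commute.one_right p).sub_right (Commute.refl p)
  have h0 : p * (1 - p) = 0 := by rw [mul_sub, mul_one, hp.eq, sub_self]
  have h0' : (1 - p) * p = 0 := by rw [sub_mul, one_mul, hp.eq, sub_self]
  have hsb : ∀ z ∈ Metric.sphere c r, z ∉ Metric.ball c r := fun z hz hz' => by
    rw [Metric.mem_sphere] at hz
    rw [Metric.mem_ball, hz] at hz'
    exact lt_irrefl _ hz'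
  have hsa : Metric.sphere c r ⊆ resolventSet ℂ a := fun z hz =>
    mem_resolventSet_of_isUnitCorner (hout z (hsb z hz))
      (hin z (Metric.sphere_subset_closedBall hz))
  -- `a₁` agrees with `a` on the corner of `p` and has its whole spectrum inside the circle. The
  -- element `a₂` below agrees with `a` on the other corner and has no spectrum in the closed disc.
  set a₁ := a * p + c • (1 - p) with ha₁
  obtain ⟨l, hl⟩ : ∃ l, l ∉ Metric.closedBall c r := by
    refine ⟨c + (2 * r : ℝ), fun h => ?_⟩
    rw [Metric.mem_closedBall, dist_eq_norm, add_sub_cancel_left, Complex.norm_real,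
      Real.norm_of_nonneg (by positivity)] at h
    linarith
  set a₂ := a * (1 - p) + l • (1 - (1 - p)) with ha₂
  have hs₁ : ∀ z, z ∉ Metric.ball c r → z ∈ resolventSet ℂ a₁ := fun z hz =>
    mem_resolventSet_corner hp hpa (hout z hz) fun h => hz (h ▸ Metric.mem_ball_self hr)
  have hs₂ : Metric.closedBall c r ⊆ resolventSet ℂ a₂ := fun z hz =>
    mem_resolventSet_corner hp1 hpa1 (hin z hz) fun h => hl (h ▸ hz)
  have hc₁ : Commute p a₁ := (hpa.mul_right (Commute.refl p)).add_right (hpp.smul_right c)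
  have hc₂ : Commute (1 - p) a₂ := (hpa1.mul_right (Commute.refl _)).add_right
    (((Commute.one_right _).sub_right (Commute.refl _)).smul_right l)
  have he₁ : p * a = p * a₁ := by
    rw [ha₁, mul_add, mul_smul_comm, h0, smul_zero, add_zero, ← mul_assoc, hpa.eq, mul_assoc, hp.eq]
  have he₂ : (1 - p) * a = (1 - p) * a₂ := by
    rw [ha₂, mul_add, mul_smul_comm, sub_sub_cancel, h0', smul_zero, add_zero, ← mul_assoc,
      hpa1.eq, mul_assoc, hp1.eq]
  have hi := circleIntegrable_resolvent hr hsa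
  have hI₁ : (∮ z in C(c, r), resolvent a z) * p = (2 * Real.pi * Complex.I : ℂ) • p := by
    rw [← circleIntegral_mul_right hi, circleIntegral.integral_congr hr.le
      (g := fun z => resolvent a₁ z * p) fun z hz =>
        resolvent_mul_corner (hsa hz) (hs₁ z (hsb z hz)) hpa hc₁ he₁,
      circleIntegral_mul_right (circleIntegrable_resolvent hr fun z hz => hs₁ z (hsb z hz)),
      circleIntegral_resolvent_eq hr fun z hz => by
        by_contra hz'
        exact hz (hs₁ z hz'), smul_mul_assoc, one_mul]
  have hI₂ : (∮ z in C(c, r), resolvent a z) * (1 - p) = 0 := by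
    rw [← circleIntegral_mul_right hi, circleIntegral.integral_congr hr.le
      (g := fun z => resolvent a₂ z * (1 - p)) fun z hz =>
        resolvent_mul_corner (hsa hz) (hs₂ (Metric.sphere_subset_closedBall hz)) hpa1 hc₂ he₂,
      circleIntegral_mul_right (circleIntegrable_resolvent hr
        (Metric.sphere_subset_closedBall.trans hs₂)),
      circleIntegral_resolvent_eq_zero hr hs₂, zero_mul]
  have hI : (∮ z in C(c, r), resolvent a z) = (2 * Real.pi * Complex.I : ℂ) • p := by
    rw [← hI₁, ← sub_eq_zero, ← hI₂, mul_sub, mul_one]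
  rw [rieszProj, hI, smul_smul, inv_mul_cancel₀ Complex.two_pi_I_ne_zero, one_smul]

end Riesz

/-! ### Circles around compact subsets of a half-plane -/

theorem exists_ball_superset_of_isCompact {S : Set ℂ} (hS : IsCompact S)
    (him : S ⊆ {z | 0 < z.im}) :
    ∃ c r, 0 < r ∧ Metric.closedBall c r ⊆ {z | 0 < z.im} ∧ S ⊆ Metric.ball c r := by
  obtain ⟨δ, hδ, hδS⟩ : ∃ δ : ℝ, 0 < δ ∧ ∀ z ∈ S, δ ≤ z.im := by
    rcases S.eq_empty_or_nonempty with rfl | hne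
    · exact ⟨1, one_pos, fun _ hz => hz.elim⟩
    · obtain ⟨z, hz, hmin⟩ := hS.exists_isMinOn hne Complex.continuous_im.continuousOn
      exact ⟨z.im, him hz, fun w hw => hmin hw⟩
  obtain ⟨M, hM⟩ := hS.isBounded.exists_norm_le
  have key : ∀ R r : ℝ, 0 ≤ r → ∀ z : ℂ,
      (‖z - R * Complex.I‖ < r ↔ z.re ^ 2 + (z.im - R) ^ 2 < r ^ 2) := fun R r hr z => by
    rw [← sq_lt_sq₀ (norm_nonneg _) hr, Complex.sq_norm, Complex.normSq_apply]
    simp [sq]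
  -- For `R = M² / δ + δ` and `z ∈ S`, `|z - iR|² ≤ M² - 2Rδ + R² < (R - δ/2)²`, since `Rδ = M² +
  -- δ²`.
  have hR : 0 < M ^ 2 / δ + δ := by positivity
  refine ⟨(M ^ 2 / δ + δ : ℝ) * Complex.I, M ^ 2 / δ + δ - δ / 2, ?_, fun z hz => ?_,
    fun z hz => ?_⟩
  · have : 0 ≤ M ^ 2 / δ := by positivity
    linarith
  · rw [Metric.mem_closedBall, dist_eq_norm] at hz
    have h := (Complex.abs_im_le_norm _).trans hz
    have h2 := neg_le_of_abs_le h
    have h3 : (((M ^ 2 / δ + δ : ℝ) : ℂ) * Complex.I).im = M ^ 2 / δ + δ := by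
      simp only [Complex.mul_im, Complex.ofReal_re, Complex.ofReal_im, Complex.I_re, Complex.I_im,
        mul_zero, add_zero, mul_one]
    rw [Complex.sub_im, h3] at h2
    change 0 < z.im
    linarith
  · have h0 : 0 ≤ M ^ 2 / δ := by positivity
    rw [Metric.mem_ball, dist_eq_norm, key _ _ (by linarith)]
    have h1 := hδS z hz
    have h2 : z.re ^ 2 + z.im ^ 2 ≤ M ^ 2 := by
      have := pow_le_pow_left₀ (norm_nonneg z) (hM z hz) 2
      rw [Complex.sq_norm, Complex.normSq_apply] at this
      linarith
    have h3 : δ * (M ^ 2 / δ) = M ^ 2 := by field_simp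
    nlinarith [mul_le_mul_of_nonneg_right h1 hR.le]

/-! ### Complex structures and the Riesz projections of the two half-planes -/

section Orientation

variable {A : Type*} [NormedRing A] [NormedAlgebra ℂ A]

/-- Without real spectrum the open half-plane can be replaced by the closed one, which makes this
part of the spectrum compact. -/
theorem exists_surroundsUpper [CompleteSpace A] {a : A} (h : ∀ t : ℝ, (t : ℂ) ∈ resolventSet ℂ a) :
    ∃ c r, SurroundsUpper a c r := by
  have he : spectrum ℂ a ∩ {z | 0 < z.im} = spectrum ℂ a ∩ {z | 0 ≤ z.im} := by
    ext z
    refine ⟨fun hz => ⟨hz.1, le_of_lt (show 0 < z.im from hz.2)⟩,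
      fun hz => ⟨hz.1, lt_of_le_of_ne (show 0 ≤ z.im from hz.2) fun h0 => ?_⟩⟩
    refine hz.1 ?_
    have : ((z.re : ℝ) : ℂ) = z := Complex.ext (by simp) (by simp [h0.symm])
    exact this ▸ h z.re
  have hc : IsCompact (spectrum ℂ a ∩ {z | 0 < z.im}) := by
    rw [he]
    exact (spectrum.isCompact a).inter_right
      (isClosed_le continuous_const Complex.continuous_im)
  exact exists_ball_superset_of_isCompact hc fun z hz => hz.2

theorem exists_surroundsLower [CompleteSpace A] {a : A} (h : ∀ t : ℝ, (t : ℂ) ∈ resolventSet ℂ a) :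
    ∃ c r, SurroundsLower a c r := by
  obtain ⟨c, r, hr, h1, h2⟩ := exists_surroundsUpper (a := -a) fun t => by
    have := h (-t)
    rw [Complex.ofReal_neg] at this
    have h' : algebraMap ℂ A t - -a = -(algebraMap ℂ A (-t) - a) := by
      rw [map_neg]
      abel
    change IsUnit _
    rw [h']
    exact IsUnit.neg this
  refine ⟨-c, r, hr, fun z hz => ?_, fun z hz => ?_⟩
  · have : -z ∈ Metric.closedBall c r := by
      rwa [Metric.mem_closedBall, ← neg_neg c, dist_neg_neg]
    simpa using h1 this
  · have : -z ∈ Metric.ball c r := h2 ⟨by simpa [← spectrum.neg_eq] using hz.1, by simpa using hz.2⟩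
    rwa [Metric.mem_ball, ← neg_neg c, dist_neg_neg] at this

variable {a j : A}

/-- The projection onto the part where the complex structure `j` agrees with `I`. -/
def upperProj (j : A) : A := (2⁻¹ : ℂ) • (1 - Complex.I • j)

theorem one_sub_upperProj (j : A) : 1 - upperProj j = (2⁻¹ : ℂ) • (1 + Complex.I • j) := by
  rw [upperProj]
  module

theorem I_smul_upperProj (j : A) :
    Complex.I • upperProj j + (-Complex.I) • (1 - upperProj j) = j := by
  have h : Complex.I • upperProj j + (-Complex.I) • (1 - upperProj j) =
      (-(Complex.I * Complex.I)) • j := by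
    rw [one_sub_upperProj, upperProj]
    module
  rw [h, Complex.I_mul_I, neg_neg, one_smul]

theorem commute_upperProj {x : A} (h : Commute j x) : Commute (upperProj j) x :=
  ((Commute.one_left x).sub_left (h.smul_left _)).smul_left _

theorem mul_upperProj (hj : j * j = -1) : j * upperProj j = Complex.I • upperProj j := by
  have h : j * upperProj j = (2⁻¹ : ℂ) • (j + Complex.I • (1 : A)) := by
    rw [upperProj, mul_smul_comm, mul_sub, mul_one, mul_smul_comm, hj, smul_neg, sub_neg_eq_add]
  have h' : Complex.I • upperProj j =
      (2⁻¹ : ℂ) • ((-(Complex.I * Complex.I)) • j + Complex.I • (1 : A)) := by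
    rw [upperProj]
    module
  rw [h, h', Complex.I_mul_I, neg_neg, one_smul]

theorem isIdempotentElem_upperProj (hj : j * j = -1) : IsIdempotentElem (upperProj j) := by
  have h : upperProj j * upperProj j =
      (2⁻¹ : ℂ) • (1 - Complex.I • Complex.I • (1 : A)) * upperProj j := by
    rw [smul_mul_assoc, sub_mul, smul_mul_assoc, smul_mul_assoc, one_mul, ← mul_upperProj hj,
      ← smul_mul_assoc, ← one_sub_mul, ← smul_mul_assoc, upperProj]
  rw [IsIdempotentElem, h, smul_smul, Complex.I_mul_I, neg_smul, one_smul, sub_neg_eq_add,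
    ← two_smul ℂ (1 : A), smul_smul, inv_mul_cancel₀ two_ne_zero, one_smul, one_mul]

theorem mul_one_sub_upperProj (hj : j * j = -1) :
    j * (1 - upperProj j) = (-Complex.I) • (1 - upperProj j) := by
  rw [mul_sub, mul_upperProj hj, mul_one]
  nth_rewrite 1 [← I_smul_upperProj j]
  abel

/-- With respect to the complex structure `j`, the element `a` lies in the upper half-plane. -/
structure IsOrientation (a j : A) : Prop where
  sq : j * j = -1
  comm : Commute j a
  isUnit : ∀ s₀ s₁ : ℝ, 0 < s₁ → IsUnit ((s₀ : ℂ) • (1 : A) - (s₁ : ℂ) • j - a)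

/-- Where `j` acts as the scalar `w`, `s₀ - s₁ j` acts as the scalar `z`. For `w = i` these `z` fill
the lower half-plane, for `w = -i` the upper one. -/
theorem IsOrientation.isUnitCorner (h : IsOrientation a j) {p : A} {z w : ℂ} {s₀ s₁ : ℝ}
    (hs : 0 < s₁) (hpa : Commute p a) (hpj : Commute p j) (hjp : j * p = w • p)
    (hz : z = s₀ - s₁ * w) : IsUnitCorner a p z := by
  refine isUnitCorner_of_isUnit (h.isUnit s₀ s₁ hs) hpa
    ((((Commute.one_right p).smul_right _).sub_right (hpj.smul_right _)).sub_right hpa) ?_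
  rw [sub_mul, sub_mul, sub_mul, smul_mul_assoc, smul_mul_assoc, one_mul, hjp, hz, smul_smul,
    ← sub_smul, Algebra.smul_def]

theorem IsOrientation.isUnitCorner_upperProj (h : IsOrientation a j) {z : ℂ} (hz : z.im < 0) :
    IsUnitCorner a (upperProj j) z := by
  refine h.isUnitCorner (s₀ := z.re) (s₁ := -z.im) (neg_pos.2 hz) (commute_upperProj h.comm)
    (commute_upperProj (Commute.refl j)) (mul_upperProj h.sq) ?_
  apply Complex.ext <;> simp

theorem IsOrientation.isUnitCorner_one_sub_upperProj (h : IsOrientation a j) {z : ℂ}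
    (hz : 0 < z.im) : IsUnitCorner a (1 - upperProj j) z := by
  refine h.isUnitCorner (s₀ := z.re) (s₁ := z.im) hz
    ((Commute.one_left a).sub_left (commute_upperProj h.comm))
    ((Commute.one_left j).sub_left (commute_upperProj (Commute.refl j)))
    (mul_one_sub_upperProj h.sq) ?_
  apply Complex.ext <;> simp

theorem isUnitCorner_of_mem_resolventSet {p : A} {z : ℂ} (hpa : Commute p a)
    (hz : z ∈ resolventSet ℂ a) : IsUnitCorner a p z :=
  isUnitCorner_of_isUnit hz hpa (commute_algebraMap_sub hpa z) rfl

variable [CompleteSpace A]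

theorem IsOrientation.rieszProj_upper (h : IsOrientation a j)
    (hr : ∀ t : ℝ, (t : ℂ) ∈ resolventSet ℂ a) {c : ℂ} {r : ℝ} (hc : SurroundsUpper a c r) :
    rieszProj a c r = upperProj j := by
  obtain ⟨h0, h1, h2⟩ := hc
  refine rieszProj_eq h0 (isIdempotentElem_upperProj h.sq) (commute_upperProj h.comm)
    (fun z hz => ?_) fun z hz => h.isUnitCorner_one_sub_upperProj (h1 hz)
  rcases lt_or_ge z.im 0 with hz0 | hz0
  · exact h.isUnitCorner_upperProj hz0
  · refine isUnitCorner_of_mem_resolventSet (commute_upperProj h.comm) ?_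
    rcases hz0.eq_or_lt with hz1 | hz1
    · have : ((z.re : ℝ) : ℂ) = z := Complex.ext (by simp) (by simp [hz1.symm])
      exact this ▸ hr z.re
    · by_contra hz2
      exact hz (h2 ⟨hz2, hz1⟩)

theorem IsOrientation.rieszProj_lower (h : IsOrientation a j)
    (hr : ∀ t : ℝ, (t : ℂ) ∈ resolventSet ℂ a) {c : ℂ} {r : ℝ} (hc : SurroundsLower a c r) :
    rieszProj a c r = 1 - upperProj j := by
  obtain ⟨h0, h1, h2⟩ := hc
  have hcomm : Commute (1 - upperProj j) a :=
    (Commute.one_left a).sub_left (commute_upperProj h.comm)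
  refine rieszProj_eq h0 (isIdempotentElem_upperProj h.sq).one_sub hcomm
    (fun z hz => ?_) fun z hz => ?_
  · rcases lt_or_ge 0 z.im with hz0 | hz0
    · exact h.isUnitCorner_one_sub_upperProj hz0
    · refine isUnitCorner_of_mem_resolventSet hcomm ?_
      rcases hz0.eq_or_lt with hz1 | hz1
      · have : ((z.re : ℝ) : ℂ) = z := Complex.ext (by simp) (by simp [hz1])
        exact this ▸ hr z.re
      · by_contra hz2
        exact hz (h2 ⟨hz2, hz1⟩)
  · rw [sub_sub_cancel]
    exact h.isUnitCorner_upperProj (h1 hz)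

/-- The right side does not involve `j`; uniqueness follows from this. -/
theorem IsOrientation.eq_rieszProj (h : IsOrientation a j)
    (hr : ∀ t : ℝ, (t : ℂ) ∈ resolventSet ℂ a) {c₁ c₂ : ℂ} {r₁ r₂ : ℝ}
    (hc₁ : SurroundsUpper a c₁ r₁) (hc₂ : SurroundsLower a c₂ r₂) :
    j = Complex.I • rieszProj a c₁ r₁ + (-Complex.I) • rieszProj a c₂ r₂ := by
  rw [h.rieszProj_upper hr hc₁, h.rieszProj_lower hr hc₂, I_smul_upperProj]

end Orientation

/-! ### Restrictions to ranges of projections -/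

section Restrict

variable {W : Type*} [NormedAddCommGroup W] [Module ℍᵐᵒᵖ W]

theorem isUnit_restrictRange {P A : W →L[ℍᵐᵒᵖ] W} (h : Commute P A) (hA : IsUnit A) :
    IsUnit (restrictRange P A h) := by
  obtain ⟨u, rfl⟩ := hA
  refine isUnit_iff_exists.2 ⟨restrictRange P ↑u⁻¹ h.units_inv_right, ?_, ?_⟩
  · ext v
    exact DFunLike.congr_fun u.mul_inv (v : W)
  · ext v
    exact DFunLike.congr_fun u.inv_mul (v : W)

theorem isUnit_of_isUnit_restrictRange {P A : W →L[ℍᵐᵒᵖ] W} (hP : P = 1) (h : Commute P A)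
    (hA : IsUnit (restrictRange P A h)) : IsUnit A := by
  obtain ⟨u, hu⟩ := hA
  have hm : ∀ v, v ∈ (P : W →ₗ[ℍᵐᵒᵖ] W).range := fun v => ⟨v, by rw [hP]; rfl⟩
  let ι : W →L[ℍᵐᵒᵖ] (P : W →ₗ[ℍᵐᵒᵖ] W).range :=
    (ContinuousLinearMap.id ℍᵐᵒᵖ W).codRestrict _ hm
  refine isUnit_iff_exists.2 ⟨(Submodule.subtypeL _).comp
    ((↑u⁻¹ : (P : W →ₗ[ℍᵐᵒᵖ] W).range →L[ℍᵐᵒᵖ] (P : W →ₗ[ℍᵐᵒᵖ] W).range).comp ι), ?_, ?_⟩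
  · ext v
    have := DFunLike.congr_fun u.mul_inv (ι v)
    rw [hu] at this
    exact congrArg Subtype.val this
  · ext v
    have := DFunLike.congr_fun u.inv_mul (ι v)
    rw [hu] at this
    exact congrArg Subtype.val this

theorem isClosed_range_of_isIdempotentElem {P : W →L[ℍᵐᵒᵖ] W} (hP : IsIdempotentElem P) :
    IsClosed ((P : W →ₗ[ℍᵐᵒᵖ] W).range : Set W) := by
  have h : ((P : W →ₗ[ℍᵐᵒᵖ] W).range : Set W) = {v | P v = v} := by
    ext v
    refine ⟨?_, fun hv => ⟨v, hv⟩⟩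
    rintro ⟨w, rfl⟩
    exact DFunLike.congr_fun hP.eq w
  rw [h]
  exact isClosed_eq P.continuous continuous_id

end Restrict

/-! ### Complements under a spectral measure and imaginary operators -/

section Basic

variable {V : Type*} [NormedAddCommGroup V] [Module ℍᵐᵒᵖ V]

/-- `sliceOp` as a ring homomorphism. -/
def sliceHom (i : imagUnits) :
    (V →L[ℍᵐᵒᵖ] V) →+* (SliceSpace i V →L[ℂ] SliceSpace i V) where
  toFun := sliceOp i
  map_one' := rfl
  map_mul' _ _ := rfl
  map_zero' := rfl
  map_add' _ _ := rfl

theorem sliceHom_apply (i : imagUnits) (A : V →L[ℍᵐᵒᵖ] V) : sliceHom i A = sliceOp i A := rfl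

theorem sliceOp_injective (i : imagUnits) :
    Function.Injective (sliceOp i : (V →L[ℍᵐᵒᵖ] V) → _) :=
  fun _ _ h => ContinuousLinearMap.ext fun v => DFunLike.congr_fun h v

/-- Countable additivity is applied to `Δᶜ, Δ, ∅, ∅, …`, where only the first term contributes. -/
theorem IsSpectralMeasure.compl_eq_one {E : Set ℍ → (V →L[ℍᵐᵒᵖ] V)} (hE : IsSpectralMeasure E)
    {Δ : Set ℍ} (hm : MeasurableSet[axialBorel] Δ) (h0 : E Δ = 0) : E Δᶜ = 1 := by
  let D : ℕ → Set ℍ := fun n => if n = 0 then Δᶜ else if n = 1 then Δ else ∅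
  have hD0 : D 0 = Δᶜ := rfl
  have hD1 : D 1 = Δ := rfl
  have hD2 : ∀ n, D (n + 2) = ∅ := fun n => rfl
  have hmD : ∀ n, MeasurableSet[axialBorel] (D n) := fun n => by
    match n with
    | 0 => exact @MeasurableSet.compl _ _ axialBorel hm
    | 1 => exact hm
    | n + 2 => exact @MeasurableSet.empty _ axialBorel
  have hdis : Pairwise (Function.onFun Disjoint D) := by
    intro m n hmn
    change Disjoint (D m) (D n)
    match m, n with
    | 0, 0 => exact absurd rfl hmn
    | 1, 1 => exact absurd rfl hmn
    | 0, 1 => exact disjoint_compl_left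
    | 1, 0 => exact disjoint_compl_right
    | m + 2, n => exact Set.empty_disjoint _
    | m, n + 2 => exact Set.disjoint_empty _
  have hun : ⋃ n, D n = Set.univ := by
    refine Set.eq_univ_of_forall fun x => ?_
    by_cases hx : x ∈ Δ
    · exact Set.mem_iUnion.2 ⟨1, hx⟩
    · exact Set.mem_iUnion.2 ⟨0, hx⟩
  ext v
  have h := hE.iUnion D hmD hdis v
  rw [hun, hE.univ] at h
  have hconst : ∀ N, ∑ n ∈ Finset.range (N + 1), E (D n) v = E Δᶜ v := fun N => by
    rw [Finset.sum_range_succ', hD0, Finset.sum_eq_zero, zero_add]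
    intro n _
    match n with
    | 0 => rw [zero_add, hD1, h0]; rfl
    | n + 1 => rw [hD2, hE.empty]; rfl
  have h' := (Filter.tendsto_add_atTop_iff_nat 1).2 h
  simp_rw [hconst] at h'
  exact tendsto_nhds_unique tendsto_const_nhds h'

theorem isImaginary_of_sq {J : V →L[ℍᵐᵒᵖ] V} (hJ : J * J = -1) : IsImaginary J := by
  have h1 : -(J ^ 2) = 1 := by rw [sq, hJ, neg_neg]
  have hJv : ∀ v, J (J v) = -v := fun v => DFunLike.congr_fun hJ v
  refine ⟨by rw [h1]; exact IsIdempotentElem.one, ?_, ?_⟩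
  · rw [h1]
    refine le_antisymm (fun v _ => ⟨-J v, ?_⟩) fun v _ => ⟨v, rfl⟩
    change J (-J v) = v
    rw [map_neg, hJv, neg_neg]
  · rw [h1]
    refine le_antisymm (fun v hv => ?_) fun v hv => ?_
    · have : v = 0 := hv
      rw [this]
      exact zero_mem _
    · have hv' : J v = 0 := hv
      change v = 0
      rw [← neg_eq_zero, ← hJv, hv', map_zero]

end Basic

/-! ### Operators on the slice spaces -/

section Slice

variable {V : Type*} [NormedAddCommGroup V] [NormedSpace ℝ V] [Module ℍᵐᵒᵖ V]
  [IsScalarTower ℝ ℍᵐᵒᵖ V]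

theorem commute_smul_right {P A : V →L[ℍᵐᵒᵖ] V} (h : Commute P A) (t : ℝ) : Commute P (t • A) := by
  refine toReal_injective ?_
  have h' := congrArg toReal h.eq
  rw [map_mul, map_mul] at h' ⊢
  rw [toReal_smul, mul_smul_comm, smul_mul_assoc, h']

theorem commute_Q {P A : V →L[ℍᵐᵒᵖ] V} (h : Commute P A) (s : ℍ) : Commute P (Q A s) :=
  ((h.pow_right 2).sub_right (commute_smul_right h _)).add_right
    (commute_smul_right (Commute.one_right P) _)

theorem isUnit_sub_real {T : V →L[ℍᵐᵒᵖ] V} (hT : sSpectrum T ∩ realAxis = ∅) (t : ℝ) :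
    IsUnit (T - t • (1 : V →L[ℍᵐᵒᵖ] V)) := by
  have h : IsUnit (Q T (t : ℍ)) := by
    by_contra hn
    exact (Set.eq_empty_iff_forall_notMem.1 hT) (t : ℍ) ⟨hn, t, rfl⟩
  -- At a real point the quadratic polynomial is a perfect square.
  have hQ : Q T (t : ℍ) = (T - t • (1 : V →L[ℍᵐᵒᵖ] V)) * (T - t • (1 : V →L[ℍᵐᵒᵖ] V)) := by
    refine toReal_injective ?_
    simp only [Q, map_add, map_sub, map_mul, sq T, map_one, toReal_smul, Quaternion.re_coe,
      Quaternion.norm_coe, Real.norm_eq_abs, sq_abs, mul_sub, sub_mul, smul_mul_assoc,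
      mul_smul_comm, one_mul, mul_one]
    module
  rw [hQ] at h
  exact ((Commute.refl _).isUnit_mul_iff.1 h).1

variable [NormSMulClass ℍᵐᵒᵖ V]

theorem sliceHom_smul (i : imagUnits) (t : ℝ) (A : V →L[ℍᵐᵒᵖ] V) :
    sliceHom i (t • A) = (t : ℂ) • sliceHom i A := by
  ext v
  change t • A v = planeHom i (t : ℂ) • A v
  rw [← Complex.coe_algebraMap, AlgHom.commutes, algebraMap_smul]

/-- The roots of `X² - 2 Re(s) X + |s|²` are `z` and its conjugate. This links the S-spectrum to the
complex spectrum on `V_i`. -/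
theorem sliceHom_Q (i : imagUnits) (A : V →L[ℍᵐᵒᵖ] V) (z : ℂ) (s : ℍ) (h0 : s.re = z.re)
    (h1 : ‖s‖ ^ 2 = Complex.normSq z) :
    sliceHom i (Q A s) =
      (algebraMap ℂ _ z - sliceHom i A) * (algebraMap ℂ _ (starRingEnd ℂ z) - sliceHom i A) := by
  have hc := Algebra.commutes (starRingEnd ℂ z) (sliceHom i A)
  have h2 : ((2 * z.re : ℝ) : ℂ) = z + starRingEnd ℂ z := by
    rw [Complex.add_conj]
  rw [Q, map_add, map_sub, map_pow, sliceHom_smul, sliceHom_smul, map_one, h0, h1, h2,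
    ← Complex.mul_conj, sub_mul, mul_sub, mul_sub, ← hc, ← map_mul, sq, ← Algebra.smul_def,
    ← Algebra.smul_def, Algebra.algebraMap_eq_smul_one (z * _), add_smul]
  abel

theorem mem_resolventSet_sliceOp {T : V →L[ℍᵐᵒᵖ] V} (hT : sSpectrum T ∩ realAxis = ∅)
    (i : imagUnits) (t : ℝ) : (t : ℂ) ∈ resolventSet ℂ (sliceOp i T) := by
  have := ((isUnit_sub_real hT t).map (sliceHom i)).neg
  rw [map_sub, sliceHom_smul, map_one, neg_sub, ← Algebra.algebraMap_eq_smul_one] at this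
  exact this

theorem nonempty_imagUnits : Nonempty imagUnits := by
  let e : ℍ := ⟨0, 1, 0, 0⟩
  refine ⟨⟨e, rfl, ?_⟩⟩
  rw [← sq_eq_sq₀ (norm_nonneg _) zero_le_one, sq, ← Quaternion.normSq_eq_norm_mul_self,
    Quaternion.normSq_def']
  norm_num [e]

/-- The S-spectrum of an operator on a nonzero space is not empty. -/
theorem subsingleton_of_sSpectrum_eq_empty [CompleteSpace V] {A : V →L[ℍᵐᵒᵖ] V}
    (h : sSpectrum A = ∅) : Subsingleton V := by
  by_contra hV
  rw [not_subsingleton_iff_nontrivial] at hV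
  obtain ⟨i⟩ := nonempty_imagUnits
  have : Nontrivial (SliceSpace i V) := hV
  obtain ⟨z, hz⟩ := spectrum.nonempty (sliceOp i A)
  let s : ℍ := ⟨z.re, z.im, 0, 0⟩
  have hs : ‖s‖ ^ 2 = Complex.normSq z := by
    rw [sq, ← Quaternion.normSq_eq_norm_mul_self, Quaternion.normSq_def', Complex.normSq_apply]
    simp [s, sq]
  have hu : IsUnit (Q A s) := by
    by_contra hn
    exact (Set.eq_empty_iff_forall_notMem.1 h) _ hn
  have := hu.map (sliceHom i)
  rw [sliceHom_Q i A z s rfl hs] at this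
  have hc : Commute (algebraMap ℂ _ z - sliceHom i A)
      (algebraMap ℂ _ (starRingEnd ℂ z) - sliceHom i A) :=
    commute_algebraMap_sub (commute_algebraMap_sub (Commute.refl (sliceHom i A)) z).symm _
  exact hz (hc.isUnit_mul_iff.1 this).1

/-- A spectral resolution vanishes on the real axis if the S-spectrum does not meet it. -/
theorem IsSpectralResolution.realAxis_eq_zero [CompleteSpace V] {T : V →L[ℍᵐᵒᵖ] V}
    {E : Set ℍ → (V →L[ℍᵐᵒᵖ] V)} (hE : IsSpectralResolution T E)
    (hT : sSpectrum T ∩ realAxis = ∅) : E realAxis = 0 := by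
  have hm := measurableSet_realAxis
  have hcl : closure realAxis = realAxis := by
    have h : realAxis = (fun x : ℍ => x.im) ⁻¹' {0} := by
      ext x
      exact mem_realAxis_iff
    rw [h]
    exact (isClosed_singleton.preimage Quaternion.continuous_im).closure_eq
  have hc := hE.comm _ hm
  have : NormSMulClass ℍᵐᵒᵖ (E realAxis : V →ₗ[ℍᵐᵒᵖ] V).range :=
    ⟨fun q v => norm_smul q (v : V)⟩
  have : CompleteSpace (E realAxis : V →ₗ[ℍᵐᵒᵖ] V).range :=
    (isClosed_range_of_isIdempotentElem (hE.measure.idem _ hm)).completeSpace_coe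
  -- A point of this S-spectrum would be real, because the real axis is closed; but `Q T s` is
  -- invertible at real `s`, and so is its restriction.
  have hemp : sSpectrum (restrictRange (E realAxis) T hc) = ∅ := by
    refine Set.eq_empty_iff_forall_notMem.2 fun s hs => ?_
    have hs' := hE.spectrum_subset _ hm hs
    rw [hcl] at hs'
    have hu : IsUnit (Q T s) := by
      by_contra hn
      exact (Set.eq_empty_iff_forall_notMem.1 hT) s ⟨hn, hs'⟩
    refine hs ?_
    -- The restriction of `Q T s` is by definition `Q` of the restriction of `T`.
    have := isUnit_restrictRange (commute_Q hc s) hu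
    exact this
  have hsub := subsingleton_of_sSpectrum_eq_empty hemp
  ext v
  exact congrArg Subtype.val (Subsingleton.elim
    (⟨E realAxis v, v, rfl⟩ : (E realAxis : V →ₗ[ℍᵐᵒᵖ] V).range) 0)

theorem isOrientation_sliceOp {T J : V →L[ℍᵐᵒᵖ] V} (hJ : J * J = -1) (hc : Commute T J)
    (hu : ∀ s₀ s₁ : ℝ, 0 < s₁ → IsUnit (s₀ • (1 : V →L[ℍᵐᵒᵖ] V) - s₁ • J - T)) (i : imagUnits) :
    IsOrientation (sliceOp i T) (sliceOp i J) where
  sq := by rw [← sliceHom_apply, ← map_mul, hJ, map_neg, map_one]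
  comm := (hc.map (sliceHom i)).symm
  isUnit s₀ s₁ hs := by
    have := (hu s₀ s₁ hs).map (sliceHom i)
    rwa [map_sub, map_sub, sliceHom_smul, sliceHom_smul, map_one] at this

theorem IsSpectralDecomposition.isOrientation [CompleteSpace V] {T J : V →L[ℍᵐᵒᵖ] V}
    {E : Set ℍ → (V →L[ℍᵐᵒᵖ] V)} (h : IsSpectralDecomposition T E J)
    (hT : sSpectrum T ∩ realAxis = ∅) (i : imagUnits) :
    IsOrientation (sliceOp i T) (sliceOp i J) := by
  have h1 : E realAxisᶜ = 1 := h.resolution.measure.compl_eq_one measurableSet_realAxis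
    (h.resolution.realAxis_eq_zero hT)
  have hJ : J * J = -1 := by rw [← neg_neg (J * J), ← sq, ← h.system.compl_real, h1]
  exact isOrientation_sliceOp hJ h.comm
    (fun s₀ s₁ hs => isUnit_of_isUnit_restrictRange h1 _ (h.inverse s₀ s₁ hs)) i

end Slice

end QuatSpectral

end

/-! ### Existence, uniqueness and the Riesz formula -/

theorem mainTheorem6 {V : Type*} [NormedAddCommGroup V] [NormedSpace ℝ V] [Module ℍᵐᵒᵖ V]
    [NormSMulClass ℍᵐᵒᵖ V] [IsScalarTower ℝ ℍᵐᵒᵖ V] [CompleteSpace V]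
    (T : V →L[ℍᵐᵒᵖ] V) (E : Set ℍ → (V →L[ℍᵐᵒᵖ] V))
    (hE : QuatSpectral.IsSpectralResolution T E)
    (hT : QuatSpectral.sSpectrum T ∩ QuatSpectral.realAxis = ∅) :
    ∃ J : V →L[ℍᵐᵒᵖ] V,
      QuatSpectral.IsSpectralDecomposition T E J ∧
      (∀ (E' : Set ℍ → (V →L[ℍᵐᵒᵖ] V)) (J' : V →L[ℍᵐᵒᵖ] V),
        QuatSpectral.IsSpectralDecomposition T E' J' → J' = J) ∧
      ∀ i : QuatSpectral.imagUnits,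
        (∃ c r, QuatSpectral.SurroundsUpper (QuatSpectral.sliceOp i T) c r) ∧
        (∃ c r, QuatSpectral.SurroundsLower (QuatSpectral.sliceOp i T) c r) ∧
        ∀ (c₁ c₂ : ℂ) (r₁ r₂ : ℝ),
          QuatSpectral.SurroundsUpper (QuatSpectral.sliceOp i T) c₁ r₁ →
          QuatSpectral.SurroundsLower (QuatSpectral.sliceOp i T) c₂ r₂ →
          QuatSpectral.sliceOp i J =
            Complex.I • QuatSpectral.rieszProj (QuatSpectral.sliceOp i T) c₁ r₁ +
              (-Complex.I) • QuatSpectral.rieszProj (QuatSpectral.sliceOp i T) c₂ r₂ := by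
  open QuatSpectral in
  obtain ⟨J, hJc, hJ, hu⟩ := exists_rightLinear_orientation (isUnit_sub_real hT)
  have hr := mem_resolventSet_sliceOp hT
  have h1 : E realAxisᶜ = 1 :=
    hE.measure.compl_eq_one measurableSet_realAxis (hE.realAxis_eq_zero hT)
  have hdec : IsSpectralDecomposition T E J :=
    { system :=
        { measure := hE.measure
          imaginary := isImaginary_of_sq hJ
          comm := fun Δ hΔ => hJc _ (hE.comm Δ hΔ)
          compl_real := by rw [h1, sq, hJ, neg_neg] }
      resolution := hE
      comm := hJc T (Commute.refl T)
      inverse := fun s₀ s₁ hs => isUnit_restrictRange _ (hu s₀ s₁ hs) }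
  refine ⟨J, hdec, fun E' J' hdec' => ?_, fun i =>
    ⟨exists_surroundsUpper (hr i), exists_surroundsLower (hr i), fun c₁ c₂ r₁ r₂ hc₁ hc₂ =>
      (hdec.isOrientation hT i).eq_rieszProj (hr i) hc₁ hc₂⟩⟩
  -- A single slice suffices for uniqueness: on it `J` and `J'` are given by the same Riesz
  -- projections of `T`.
  obtain ⟨i⟩ := nonempty_imagUnits
  obtain ⟨c₁, r₁, hc₁⟩ := exists_surroundsUpper (hr i)
  obtain ⟨c₂, r₂, hc₂⟩ := exists_surroundsLower (hr i)
  refine sliceOp_injective i ?_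
  rw [(hdec.isOrientation hT i).eq_rieszProj (hr i) hc₁ hc₂,
    (hdec'.isOrientation hT i).eq_rieszProj (hr i) hc₁ hc₂]
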